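/- **Lemma.** A link is a (tame, unoriented) link in $3$-space up to isotopy, equivalently a link diagram up to planar isotopy and Reidemeister moves. It is *split* if it is the distant union of two non-empty links. For $m>1$, a *Fox $m$-coloring* of a link diagram assigns to each arc an element of $\mathbb{Z}/m$ such that at each crossing twice the color of the over-arc equals the sum of the colors of the two under-arcs; it is *non-trivial* if at least two colors occur. A link is *$m$-colorable* if some diagram of it has a non-trivial $m$-coloring, and then $\mathrm{mincol}_m L$ denotes the least number of colors that occur in a non-trivial $m$-coloring of a diagram of $L$. The determinant $\det L$ is the non-negative greatest common divisor of the $(N-1)\times(N-1)$ minors of the integral coloring matrix of a diagram of $L$ with $N$ arcs (one row for each crossing, expressing the relation $2\cdot\text{over}-\text{under}-\text{under}'=0$). For $n\ge 2$ let $P_n$ be the pretzel link $P(\underbrace{2,-2,\ldots,2,-2}_{2n})$ with $2n$ columns. The links $P_n$ ($n\ge2$) are pairwise different, and for every integer $m\ge 5$ and every $n\ge 2$ the link $P_n$ is non-split, has determinant $0$ (computed from any diagram), is $m$-colorable, and satisfies $\mathrm{mincol}_m P_n\le 4$. In particular, for every $m\geq 5$ there are infinitely many non-split $m$-colorable links $L$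 with $\det L=0$ and $\mathrm{mincol}_m L\le 4$. Consequently the following lower bounds, which hold for links with non-zero determinant (the third one for knots), do not extend to non-split links: 1. for no prime $p\ge 11$ does $\mathrm{mincol}_p L\ge 5$ hold for all non-split $p$-colorable links $L$; 2. for no prime $p\ge 17$ does $\mathrm{mincol}_p L\ge 6$ hold for all non-split $p$-colorable links $L$; 3. for no prime $p\ge 11$ does $\mathrm{mincol}_p L\ge\lfloor\log_2 p\rfloor+2$ hold for all non-split $p$-colorable links $L$. -/

import Mathlib

/-! # Link diagrams, links, Fox colorings, determinants and pretzel links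

Links are taken as link diagrams up to planar isotopy and Reidemeister moves. A diagram is put in
general position with respect to a height function and read from bottom to top as a sequence of
slices, each of which holds a single local minimum, local maximum or crossing. -/

/-- The elementary pieces: a local minimum `cup`, a local maximum `cap`, and a crossing.
In `cross true` the strand from bottom left to top right is the over-strand, in `cross false`
the strand from bottom right to top left is. -/
inductive Piece : Type
  | cup : Piece
  | cap : Piece
  | cross (b : Bool) : Piece
  deriving DecidableEq

/-- The number of strands that enter a piece from below. -/
def Piece.ins : Piece → ℕ
  | .cup => 0
  | .cap => 2
  | .cross _ => 2

/-- The number of strands that leave a piece at the top. -/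
def Piece.outs : Piece → ℕ
  | .cup => 2
  | .cap => 0
  | .cross _ => 2

/-- A slice: one piece with `pos` vertical strands to its left (and any number of vertical strands
to its right). Strands are numbered from the left, starting with `0`. -/
structure Slice : Type where
  piece : Piece
  pos : ℕ
  deriving DecidableEq

/-- The list of slices `w`, read from bottom to top, is a tangle diagram with `k` end points at
the bottom and `l` end points at the top. -/
def IsTangle : List Slice → ℕ → ℕ → Prop
  | [], k, l => k = l
  | s :: w, k, l => s.pos + s.piece.ins ≤ k ∧ IsTangle w (k - s.piece.ins + s.piece.outs) l

/-- A link diagram: a tangle diagram without end points. -/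
structure LinkDiagram : Type where
  word : List Slice
  closed : IsTangle word 0 0

/-- The local moves on tangle diagrams: planar isotopies that change the order of heights of the
critical points and crossings, and the three Reidemeister moves. -/
inductive LocalMove : List Slice → List Slice → Prop
  /-- Two pieces side by side exchange heights; `t` stands to the right of `s`, with `d` vertical
  strands between them. -/
  | exchange (s t : Piece) (i d : ℕ) :
      LocalMove [⟨s, i⟩, ⟨t, i + s.outs + d⟩] [⟨t, i + s.ins + d⟩, ⟨s, i⟩]
  /-- A minimum and a maximum next to each other on a strand cancel. -/
  | zigzagLeft (i : ℕ) : LocalMove [⟨.cup, i + 1⟩, ⟨.cap, i⟩] []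
  | zigzagRight (i : ℕ) : LocalMove [⟨.cup, i⟩, ⟨.cap, i + 1⟩] []
  /-- A strand passes over or under a maximum, respectively a minimum. -/
  | slideCap (b : Bool) (i : ℕ) :
      LocalMove [⟨.cross b, i⟩, ⟨.cap, i + 1⟩] [⟨.cross (!b), i + 1⟩, ⟨.cap, i⟩]
  | slideCup (b : Bool) (i : ℕ) :
      LocalMove [⟨.cup, i + 1⟩, ⟨.cross b, i⟩] [⟨.cup, i⟩, ⟨.cross (!b), i + 1⟩]
  /-- First Reidemeister move. -/
  | reidemeisterOneCup (b : Bool) (i : ℕ) : LocalMove [⟨.cup, i⟩, ⟨.cross b, i⟩] [⟨.cup, i⟩]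
  | reidemeisterOneCap (b : Bool) (i : ℕ) : LocalMove [⟨.cross b, i⟩, ⟨.cap, i⟩] [⟨.cap, i⟩]
  /-- Second Reidemeister move. -/
  | reidemeisterTwo (b : Bool) (i : ℕ) : LocalMove [⟨.cross b, i⟩, ⟨.cross (!b), i⟩] []
  /-- Third Reidemeister move. -/
  | reidemeisterThree (b : Bool) (i : ℕ) :
      LocalMove [⟨.cross b, i⟩, ⟨.cross b, i + 1⟩, ⟨.cross b, i⟩]
        [⟨.cross b, i + 1⟩, ⟨.cross b, i⟩, ⟨.cross b, i + 1⟩]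

/-- `D'` arises from `D` by one local move. -/
def LinkDiagram.Move (D D' : LinkDiagram) : Prop :=
  ∃ u v w w' : List Slice, LocalMove w w' ∧ D.word = u ++ w ++ v ∧ D'.word = u ++ w' ++ v

/-- (Unoriented) links: link diagrams up to the equivalence relation generated by the moves. -/
def Link : Type := Quot LinkDiagram.Move

/-- The link presented by a diagram. -/
def LinkDiagram.link (D : LinkDiagram) : Link := Quot.mk _ D

/-! ## Splitting -/

theorem IsTangle.append {u v : List Slice} {k l r : ℕ} (hu : IsTangle u k l)
    (hv : IsTangle v l r) : IsTangle (u ++ v) k r := by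
  induction u generalizing k with
  | nil => cases hu; exact hv
  | cons s u ih => exact ⟨hu.1, ih hu.2⟩

/-- The disjoint diagram of `D₁` and `D₂`, with `D₂` drawn above `D₁`. -/
def LinkDiagram.stack (D₁ D₂ : LinkDiagram) : LinkDiagram :=
  ⟨D₁.word ++ D₂.word, D₁.closed.append D₂.closed⟩

/-- A link is split if it is the distant union of two non-empty links, i.e. has a diagram whose
upper and lower parts are disjoint non-empty link diagrams. -/
def Link.IsSplit (L : Link) : Prop :=
  ∃ D₁ D₂ : LinkDiagram, D₁.word ≠ [] ∧ D₂.word ≠ [] ∧ (D₁.stack D₂).link = L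

/-! ## Arcs, crossings and Fox colorings -/

/-- The number of strands at the top of the list of slices `w`, which starts with no strands. -/
def width (w : List Slice) : ℕ :=
  w.foldl (fun k s => k - s.piece.ins + s.piece.outs) 0

/-- The points `(t, j)` where a diagram meets the horizontal lines between its slices:
`t` is the number of slices below the line, `j` the number of points to the left on the line. -/
def LinkDiagram.Point (D : LinkDiagram) : Type :=
  {p : ℕ × ℕ // p.1 ≤ D.word.length ∧ p.2 < width (D.word.take p.1)}

/-- Two points on the boundary of one slice are joined, inside that slice, by a piece of the
diagram that does not pass under a crossing. -/
inductive SliceJoined (w : List Slice) : ℕ × ℕ → ℕ × ℕ → Prop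
  | left (t j : ℕ) (s : Slice) : w[t]? = some s → j < s.pos → SliceJoined w (t, j) (t + 1, j)
  | right (t j : ℕ) (s : Slice) : w[t]? = some s →
      SliceJoined w (t, s.pos + s.piece.ins + j) (t + 1, s.pos + s.piece.outs + j)
  | cup (t i : ℕ) : w[t]? = some ⟨.cup, i⟩ → SliceJoined w (t + 1, i) (t + 1, i + 1)
  | cap (t i : ℕ) : w[t]? = some ⟨.cap, i⟩ → SliceJoined w (t, i) (t, i + 1)
  | overTrue (t i : ℕ) : w[t]? = some ⟨.cross true, i⟩ → SliceJoined w (t, i) (t + 1, i + 1)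
  | overFalse (t i : ℕ) : w[t]? = some ⟨.cross false, i⟩ → SliceJoined w (t, i + 1) (t + 1, i)

/-- The arcs of a diagram: its pieces from undercrossing to undercrossing, and the components
without undercrossings. -/
def LinkDiagram.Arc (D : LinkDiagram) : Type :=
  Quot (fun p q : D.Point => SliceJoined D.word p.1 q.1)

/-- The arc through a point. -/
def LinkDiagram.arc (D : LinkDiagram) (p : D.Point) : D.Arc := Quot.mk _ p

/-- At some crossing, `o` is a point of the over-strand and `u`, `v` are the points on the two
sides of the under-strand. -/
inductive CrossingAt (w : List Slice) : ℕ × ℕ → ℕ × ℕ → ℕ × ℕ → Prop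
  | crossTrue (t i : ℕ) : w[t]? = some ⟨.cross true, i⟩ →
      CrossingAt w (t, i) (t, i + 1) (t + 1, i)
  | crossFalse (t i : ℕ) : w[t]? = some ⟨.cross false, i⟩ →
      CrossingAt w (t, i + 1) (t, i) (t + 1, i + 1)

/-- The crossings of a diagram, each given by its points `o`, `u`, `v`. -/
def LinkDiagram.Crossing (D : LinkDiagram) : Type :=
  {x : D.Point × D.Point × D.Point // CrossingAt D.word x.1.1 x.2.1.1 x.2.2.1}

/-- The over-arc at a crossing. -/
def LinkDiagram.over (D : LinkDiagram) (x : D.Crossing) : D.Arc := D.arc x.1.1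

/-- The first under-arc at a crossing. -/
def LinkDiagram.under₁ (D : LinkDiagram) (x : D.Crossing) : D.Arc := D.arc x.1.2.1

/-- The second under-arc at a crossing. -/
def LinkDiagram.under₂ (D : LinkDiagram) (x : D.Crossing) : D.Arc := D.arc x.1.2.2

/-- Fox `m`-colorings of a diagram. -/
def LinkDiagram.IsColoring (D : LinkDiagram) (m : ℕ) (f : D.Arc → ZMod m) : Prop :=
  ∀ x : D.Crossing, 2 * f (D.over x) = f (D.under₁ x) + f (D.under₂ x)

/-- Non-trivial Fox `m`-colorings: at least two colors occur. -/
def LinkDiagram.IsNontrivialColoring (D : LinkDiagram) (m : ℕ) (f : D.Arc → ZMod m) : Prop :=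
  D.IsColoring m f ∧ ∃ a b : D.Arc, f a ≠ f b

/-- A link is `m`-colorable if it has a diagram with a non-trivial `m`-coloring. -/
def Link.IsColorable (L : Link) (m : ℕ) : Prop :=
  ∃ D : LinkDiagram, D.link = L ∧ ∃ f : D.Arc → ZMod m, D.IsNontrivialColoring m f

/-- The minimum number of colors of an `m`-colorable link: the least number of colors in a
non-trivial `m`-coloring of a diagram of the link. (The value is `0` if `L` is not
`m`-colorable.) -/
noncomputable def Link.mincol (L : Link) (m : ℕ) : ℕ :=
  sInf {k : ℕ | ∃ D : LinkDiagram, D.link = L ∧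
    ∃ f : D.Arc → ZMod m, D.IsNontrivialColoring m f ∧ (Set.range f).ncard = k}

/-! ## The determinant -/

open Classical in
/-- The integral coloring matrix of a diagram, with one row for each crossing and one column for
each arc. -/
noncomputable def LinkDiagram.coloringMatrix (D : LinkDiagram) : Matrix D.Crossing D.Arc ℤ :=
  Matrix.of fun x a =>
    2 * (if a = D.over x then 1 else 0) - (if a = D.under₁ x then 1 else 0)
      - (if a = D.under₂ x then 1 else 0)

/-- The ideal of `ℤ` generated by the minors of order `N - 1` of the coloring matrix, where `N` is
the number of arcs. -/
noncomputable def LinkDiagram.minorIdeal (D : LinkDiagram) : Ideal ℤ :=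
  Ideal.span {d : ℤ | ∃ (r : Fin (Nat.card D.Arc - 1) → D.Crossing)
    (c : Fin (Nat.card D.Arc - 1) → D.Arc), d = (D.coloringMatrix.submatrix r c).det}

/-- The determinant of a link diagram: the non-negative greatest common divisor of the minors of
order `N - 1` of the coloring matrix, where `N` is the number of arcs. When the diagram has as many
crossings as arcs, all these minors agree up to sign, and this is their common absolute value. -/
noncomputable def LinkDiagram.det (D : LinkDiagram) : ℕ :=
  (Submodule.IsPrincipal.generator D.minorIdeal).natAbs

/-! ## Pretzel links -/

/-- Columns of crossings of two adjacent strands, side by side: the first column is on the strands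
`i` and `i + 1`, the next on `i + 2` and `i + 3`, and so on. A column with entry `a` has `|a|`
crossings, whose type is given by the sign of `a`. -/
def twistColumns : ℕ → List ℤ → List Slice
  | _, [] => []
  | i, a :: p => List.replicate a.natAbs ⟨.cross (decide (0 < a)), i⟩ ++ twistColumns (i + 2) p

theorem isTangle_replicate_cross (b : Bool) (i k n : ℕ) (h : i + 2 ≤ k) :
    IsTangle (List.replicate n ⟨.cross b, i⟩) k k := by
  induction n with
  | zero => rfl
  | succ n ih =>
    refine ⟨h, ?_⟩
    have e : k - (Piece.cross b).ins + (Piece.cross b).outs = k := by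
      simp only [Piece.ins, Piece.outs]; omega
    simpa only [e] using ih

theorem isTangle_twistColumns (p : List ℤ) (i k : ℕ) (h : i + 2 * p.length ≤ k) :
    IsTangle (twistColumns i p) k k := by
  induction p generalizing i with
  | nil => rfl
  | cons a p ih =>
    simp only [List.length_cons] at h
    exact (isTangle_replicate_cross _ i k _ (by omega)).append (ih (i + 2) (by omega))

theorem isTangle_replicate_cup (n k : ℕ) (h : 1 ≤ k) :
    IsTangle (List.replicate n ⟨.cup, 1⟩) k (k + 2 * n) := by
  induction n generalizing k with
  | zero => rfl
  | succ n ih =>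
    refine ⟨h, ?_⟩
    have e : k + 2 * (n + 1) = (k + 2) + 2 * n := by omega
    rw [e]
    exact ih (k + 2) (by omega)

theorem isTangle_replicate_cap (n k : ℕ) (h : 1 ≤ k) :
    IsTangle (List.replicate n ⟨.cap, 1⟩) (k + 2 * n) k := by
  induction n with
  | zero => rfl
  | succ n ih =>
    refine ⟨by simp only [Piece.ins]; omega, ?_⟩
    have e : k + 2 * (n + 1) - Piece.cap.ins + Piece.cap.outs = k + 2 * n := by
      simp only [Piece.ins, Piece.outs]; omega
    simpa only [e] using ih

/-- The standard diagram of the pretzel link `P(p₁, …, pₙ)`, `n ≥ 1`: the columns with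
`p₁, …, pₙ` crossings stand side by side, and at the top and at the bottom each column is connected
to the next one, and the last one to the first. -/
def pretzelDiagram (p : List ℤ) : LinkDiagram where
  word := (⟨.cup, 0⟩ :: List.replicate (p.length - 1) ⟨.cup, 1⟩) ++ twistColumns 0 p
    ++ (List.replicate (p.length - 1) ⟨.cap, 1⟩ ++ [⟨.cap, 0⟩])
  closed := by
    have h₁ : IsTangle (⟨.cup, 0⟩ :: List.replicate (p.length - 1) ⟨.cup, 1⟩) 0
        (2 + 2 * (p.length - 1)) :=
      ⟨le_refl 0, isTangle_replicate_cup _ 2 (by omega)⟩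
    have h₂ := isTangle_twistColumns p 0 (2 + 2 * (p.length - 1)) (by omega)
    have h₃ := isTangle_replicate_cap (p.length - 1) 2 (by omega)
    exact (h₁.append h₂).append (h₃.append ⟨le_refl 2, rfl⟩)

/-- The sequence `2, -2, …, 2, -2` of length `2 * n`. -/
def alternatingTwos (n : ℕ) : List ℤ := (List.replicate n [2, -2]).flatten

/-- The pretzel link `P(2, -2, …, 2, -2)` with `2 * n` columns. -/
def alternatingPretzel (n : ℕ) : Link := (pretzelDiagram (alternatingTwos n)).link

/-! # Colorings of diagrams by involutory quandles -/

/-! The proof studies colorings by an arbitrary involutory quandle, recorded level by level. A local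
move changes a coloring only inside the moved part, and there in exactly one way. Hence two diagrams
of one link have colorings in bijection, and uniqueness makes these bijections natural in the
quandle (`LinkDiagram.Move.equivalent`). Naturality with respect to constant maps preserves being
constant (`Coloring.isConst_apply_iff`). Different quandles then give the different claims.

For `ℤ` with `x ◁ y = 2y - x`, the diagram of `P_n` has a non-constant coloring with colors in `{0,
1, -1, -2}`. Its reduction modulo `m` bounds the number of colors by four. Transported to any
diagram of the link, the integral coloring gives a kernel vector for each square submatrix of order
`N - 1` with distinct columns, so the determinant vanishes (`Coloring.det_eq_zero`).

For the trivial quandle `Bool`, colorings are functions on the components. There are `2 ^ (2n)` of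
them, which tells the links apart.

For `Marked`, a marking `(f, g)` of the components lifts to a coloring only if certain mod 2 sums of
linking numbers vanish. On a split link, take `f` to be the side of the splitting; every `g` then
lifts. In `P_n` the components form a cycle of circles, each clasped with the next. If `f` is not
constant, two neighbors differ in `f`; letting `g` mark just these two gives an odd sum, so there is
no lift (`not_separable`). -/

/-- Involutory quandles; `op x y` is the color of the under-strand after `x` passed under `y`. -/
class Kei (Q : Type) where
  op : Q → Q → Q
  op_self : ∀ x, op x x = x
  op_op : ∀ x y, op (op x y) y = x
  op_distrib : ∀ x y z, op (op x y) z = op (op x z) (op y z)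

namespace Kei

local infixl:70 " ◁ " => Kei.op

/-- Homomorphisms of involutory quandles. -/
def IsHom {Q R : Type} [Kei Q] [Kei R] (φ : Q → R) : Prop :=
  ∀ x y, φ (x ◁ y) = φ x ◁ φ y

variable {Q R : Type} [Kei Q] [Kei R]

theorem isHom_const (q : R) : IsHom (fun _ : Q => q) := fun _ _ => (op_self q).symm

/-! ### Colorings recorded level by level -/

/-- The colors `a` below and `b` above a slice with piece `s` at position `i` fit together. -/
def Step : Piece → ℕ → List Q → List Q → Prop
  | s, i + 1, a, b => ∃ x a' b', a = x :: a' ∧ b = x :: b' ∧ Step s i a' b'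
  | .cup, 0, a, b => ∃ q, b = q :: q :: a
  | .cap, 0, a, b => ∃ q, a = q :: q :: b
  | .cross true, 0, a, b => ∃ p q r, a = p :: q :: r ∧ b = (q ◁ p) :: p :: r
  | .cross false, 0, a, b => ∃ p q r, a = p :: q :: r ∧ b = q :: (p ◁ q) :: r

/-- `L` lists the colors on the levels above each slice of `w`, where `a` are the colors at the
bottom and `b` those at the top. -/
def IsColored : List Slice → List Q → List (List Q) → List Q → Prop
  | [], a, L, b => L = [] ∧ a = b
  | s :: w, a, L, b => ∃ c L', L = c :: L' ∧ Step s.piece s.pos a c ∧ IsColored w c L' b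

theorem step_succ_cons {s : Piece} {i : ℕ} {x : Q} {a b : List Q} :
    Step s (i + 1) (x :: a) b ↔ ∃ b', b = x :: b' ∧ Step s i a b' := by
  simp only [Step, List.cons.injEq]
  constructor
  · rintro ⟨_, _, b', ⟨rfl, rfl⟩, rfl, h⟩
    exact ⟨b', rfl, h⟩
  · rintro ⟨b', rfl, h⟩
    exact ⟨x, a, b', ⟨rfl, rfl⟩, rfl, h⟩

theorem step_succ_nil {s : Piece} {i : ℕ} {b : List Q} : ¬ Step s (i + 1) [] b := by
  simp [Step]

theorem step_cross_true_zero {p q : Q} {a b : List Q} :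
    Step (.cross true) 0 (p :: q :: a) b ↔ b = (q ◁ p) :: p :: a := by
  simp only [Step, List.cons.injEq]
  constructor
  · rintro ⟨_, _, _, ⟨rfl, rfl, rfl⟩, rfl⟩; rfl
  · rintro rfl; exact ⟨p, q, a, ⟨rfl, rfl, rfl⟩, rfl⟩

theorem step_cross_false_zero {p q : Q} {a b : List Q} :
    Step (.cross false) 0 (p :: q :: a) b ↔ b = q :: (p ◁ q) :: a := by
  simp only [Step, List.cons.injEq]
  constructor
  · rintro ⟨_, _, _, ⟨rfl, rfl, rfl⟩, rfl⟩; rfl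
  · rintro rfl; exact ⟨p, q, a, ⟨rfl, rfl, rfl⟩, rfl⟩

theorem Step.length {s : Piece} {i : ℕ} {a b : List Q} (h : Step s i a b) :
    i + s.ins ≤ a.length ∧ b.length = a.length - s.ins + s.outs := by
  induction i generalizing a b with
  | zero =>
    rcases s with _ | _ | _ | _ <;> simp only [Step] at h
    · obtain ⟨q, rfl⟩ := h; simp [Piece.ins, Piece.outs]
    · obtain ⟨q, rfl⟩ := h; simp [Piece.ins, Piece.outs]
    · obtain ⟨p, q, r, rfl, rfl⟩ := h; simp [Piece.ins, Piece.outs]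
    · obtain ⟨p, q, r, rfl, rfl⟩ := h; simp [Piece.ins, Piece.outs]
  | succ i ih =>
    obtain ⟨x, a', b', rfl, rfl, h⟩ := h
    have := ih h
    simp only [List.length_cons]
    omega

theorem Step.map {φ : Q → R} (hφ : IsHom φ) {s : Piece} {i : ℕ} {a b : List Q}
    (h : Step s i a b) : Step s i (a.map φ) (b.map φ) := by
  induction i generalizing a b with
  | zero =>
    rcases s with _ | _ | _ | _ <;> simp only [Step] at h ⊢
    · obtain ⟨q, rfl⟩ := h; exact ⟨φ q, rfl⟩
    · obtain ⟨q, rfl⟩ := h; exact ⟨φ q, rfl⟩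
    · obtain ⟨p, q, r, rfl, rfl⟩ := h; exact ⟨φ p, φ q, r.map φ, rfl, by simp [hφ _ _]⟩
    · obtain ⟨p, q, r, rfl, rfl⟩ := h; exact ⟨φ p, φ q, r.map φ, rfl, by simp [hφ _ _]⟩
  | succ i ih =>
    obtain ⟨x, a', b', rfl, rfl, h⟩ := h
    exact ⟨φ x, _, _, rfl, rfl, ih h⟩

theorem isColored_append {u v : List Slice} {a b : List Q} {L : List (List Q)} :
    IsColored (u ++ v) a L b ↔
      ∃ L₁ L₂ c, L = L₁ ++ L₂ ∧ IsColored u a L₁ c ∧ IsColored v c L₂ b := by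
  induction u generalizing a L with
  | nil =>
    constructor
    · intro h; exact ⟨[], L, a, rfl, ⟨rfl, rfl⟩, h⟩
    · rintro ⟨_, L₂, c, rfl, ⟨rfl, rfl⟩, h⟩; exact h
  | cons s u ih =>
    simp only [List.cons_append, IsColored, ih]
    constructor
    · rintro ⟨c, _, rfl, hs, L₁, L₂, d, rfl, h₁, h₂⟩
      exact ⟨c :: L₁, L₂, d, rfl, ⟨c, L₁, rfl, hs, h₁⟩, h₂⟩
    · rintro ⟨_, L₂, d, rfl, ⟨c, L₁, rfl, hs, h₁⟩, h₂⟩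
      exact ⟨c, _, rfl, hs, L₁, L₂, d, rfl, h₁, h₂⟩

theorem IsColored.append {u v : List Slice} {a b c : List Q} {L₁ L₂ : List (List Q)}
    (h₁ : IsColored u a L₁ b) (h₂ : IsColored v b L₂ c) :
    IsColored (u ++ v) a (L₁ ++ L₂) c :=
  isColored_append.2 ⟨_, _, _, rfl, h₁, h₂⟩

theorem IsColored.length_levels {w : List Slice} {a b : List Q} {L : List (List Q)}
    (h : IsColored w a L b) : L.length = w.length := by
  induction w generalizing a L with
  | nil => rw [h.1]; rfl
  | cons s w ih =>
    obtain ⟨c, L', rfl, -, h⟩ := h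
    simp [ih h]

theorem IsColored.isTangle {w : List Slice} {a b : List Q} {L : List (List Q)}
    (h : IsColored w a L b) : IsTangle w a.length b.length := by
  induction w generalizing a L with
  | nil => rw [h.2]; rfl
  | cons s w ih =>
    obtain ⟨c, L', rfl, hs, h⟩ := h
    refine ⟨hs.length.1, ?_⟩
    rw [← hs.length.2]
    exact ih h

theorem IsColored.map {φ : Q → R} (hφ : IsHom φ) {w : List Slice} {a b : List Q}
    {L : List (List Q)} (h : IsColored w a L b) :
    IsColored w (a.map φ) (L.map (List.map φ)) (b.map φ) := by
  induction w generalizing a L with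
  | nil => obtain ⟨rfl, rfl⟩ := h; exact ⟨rfl, rfl⟩
  | cons s w ih =>
    obtain ⟨c, L', rfl, hs, h⟩ := h
    exact ⟨_, _, rfl, hs.map hφ, ih h⟩

/-- Only a minimum introduces a free color; every other piece determines the colors above it from
those below. -/
theorem Step.eq_of_ne_cup {s : Piece} (hs : s ≠ .cup) {i : ℕ} {a b b' : List Q}
    (h : Step s i a b) (h' : Step s i a b') : b = b' := by
  induction i generalizing a b b' with
  | zero =>
    rcases s with _ | _ | _ | _ <;> simp only [Step] at h h'
    · exact absurd rfl hs
    · obtain ⟨q, rfl⟩ := h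
      obtain ⟨q', e⟩ := h'
      simp_all
    · obtain ⟨p, q, r, rfl, rfl⟩ := h
      obtain ⟨p', q', r', e, rfl⟩ := h'
      simp_all
    · obtain ⟨p, q, r, rfl, rfl⟩ := h
      obtain ⟨p', q', r', e, rfl⟩ := h'
      simp_all
  | succ i ih =>
    obtain ⟨x, a, b, rfl, rfl, h⟩ := h
    obtain ⟨b', rfl, h₂⟩ := step_succ_cons.1 h'
    rw [ih h h₂]

/-- A minimum is deterministic when read downwards. This complements `Step.eq_of_ne_cup`. -/
theorem Step.cup_eq {i : ℕ} {a a' b : List Q}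
    (h : Step .cup i a b) (h' : Step .cup i a' b) : a = a' := by
  induction i generalizing a a' b with
  | zero =>
    obtain ⟨q, rfl⟩ := h
    obtain ⟨q', e⟩ := h'
    simp_all
  | succ i ih =>
    obtain ⟨x, a, b, rfl, rfl, h⟩ := h
    obtain ⟨x', a', b', rfl, e, h'⟩ := h'
    obtain ⟨rfl, rfl⟩ : x = x' ∧ b = b' := by simpa using e
    rw [ih h h']

theorem IsColored.eq_of_forall_ne_cup {w : List Slice} (hw : ∀ s ∈ w, s.piece ≠ .cup)
    {a b b' : List Q} {L L' : List (List Q)} (h : IsColored w a L b) (h' : IsColored w a L' b') :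
    L = L' ∧ b = b' := by
  induction w generalizing a L L' with
  | nil => exact ⟨h.1.trans h'.1.symm, h.2.symm.trans h'.2⟩
  | cons s w ih =>
    obtain ⟨c, L, rfl, hs, h⟩ := h
    obtain ⟨c', L', rfl, hs', h'⟩ := h'
    obtain rfl := hs.eq_of_ne_cup (hw s (by simp)) hs'
    obtain ⟨rfl, rfl⟩ := ih (fun t ht => hw t (by simp [ht])) h h'
    exact ⟨rfl, rfl⟩

theorem IsColored.eq_of_forall_eq_cup {w : List Slice} (hw : ∀ s ∈ w, s.piece = .cup)
    {a a' b : List Q} {L L' : List (List Q)} (h : IsColored w a L b) (h' : IsColored w a' L' b) :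
    L = L' ∧ a = a' := by
  induction w generalizing a a' L L' with
  | nil => exact ⟨h.1.trans h'.1.symm, h.2.trans h'.2.symm⟩
  | cons s w ih =>
    obtain ⟨c, L, rfl, hs, h⟩ := h
    obtain ⟨c', L', rfl, hs', h'⟩ := h'
    obtain ⟨rfl, rfl⟩ := ih (fun t ht => hw t (by simp [ht])) h h'
    rw [hw s (by simp)] at hs hs'
    exact ⟨rfl, hs.cup_eq hs'⟩

/-- The tangle diagram `w` with a further vertical strand on the left. -/
def addStrand (w : List Slice) : List Slice := w.map fun s => ⟨s.piece, s.pos + 1⟩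

theorem isColored_addStrand {w : List Slice} {x : Q} {a b : List Q} {L : List (List Q)} :
    IsColored (addStrand w) (x :: a) L b ↔
      ∃ L' b', L = L'.map (List.cons x) ∧ b = x :: b' ∧ IsColored w a L' b' := by
  induction w generalizing a L with
  | nil =>
    constructor
    · rintro ⟨rfl, rfl⟩; exact ⟨[], a, rfl, rfl, rfl, rfl⟩
    · rintro ⟨_, _, rfl, rfl, rfl, rfl⟩; exact ⟨rfl, rfl⟩
  | cons s w ih =>
    constructor
    · rintro ⟨c, L', rfl, hs, h⟩
      obtain ⟨c', rfl, hs'⟩ := step_succ_cons.1 hs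
      obtain ⟨L'', b', rfl, rfl, h'⟩ := ih.1 h
      exact ⟨c' :: L'', b', rfl, rfl, _, _, rfl, hs', h'⟩
    · rintro ⟨_, b', rfl, rfl, c, L', rfl, hs, h⟩
      exact ⟨_, _, rfl, step_succ_cons.2 ⟨_, rfl, hs⟩, ih.2 ⟨_, _, rfl, rfl, h⟩⟩

theorem IsTangle.of_addStrand {w : List Slice} {k l : ℕ} (h : IsTangle (addStrand w) (k + 1) l) :
    ∃ l', IsTangle w k l' := by
  induction w generalizing k with
  | nil => exact ⟨k, rfl⟩
  | cons s w ih =>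
    obtain ⟨h₁, h₂⟩ := h
    simp only at h₁
    have e : k + 1 - s.piece.ins + s.piece.outs = k - s.piece.ins + s.piece.outs + 1 := by omega
    simp only [e] at h₂
    obtain ⟨l', h'⟩ := ih h₂
    exact ⟨l', by omega, h'⟩

/-! ## Invariance under the local moves -/

/-- A coloring of the ends of `w` extends to at most one coloring of `w`, and then also to a
coloring of `w'` (if there are enough strands). -/
def Transfers (Q : Type) [Kei Q] (w w' : List Slice) : Prop :=
  (∀ (a b : List Q) (L L' : List (List Q)), IsColored w a L b → IsColored w a L' b → L = L') ∧
  ∀ (a b : List Q) (L : List (List Q)) (l : ℕ), IsTangle w' a.length l → IsColored w a L b →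
    ∃ L', IsColored w' a L' b

/-- This reduces every local move to its leftmost position. -/
theorem Transfers.addStrand {w w' : List Slice} (h : Transfers Q w w') :
    Transfers Q (addStrand w) (addStrand w') := by
  constructor
  · intro a b L L' hL hL'
    rcases a with _ | ⟨x, a⟩
    · rcases w with _ | ⟨s, w⟩
      · rw [hL.1, hL'.1]
      · obtain ⟨c, _, _, hs, _⟩ := hL
        exact absurd hs step_succ_nil
    · obtain ⟨L₁, b₁, rfl, rfl, h₁⟩ := isColored_addStrand.1 hL
      obtain ⟨L₂, b₂, rfl, e, h₂⟩ := isColored_addStrand.1 hL'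
      obtain rfl : b₁ = b₂ := by simpa using e
      rw [h.1 _ _ _ _ h₁ h₂]
  · intro a b L l hl hL
    rcases a with _ | ⟨x, a⟩
    · rcases w' with _ | ⟨s, w'⟩
      · rcases w with _ | ⟨s, w⟩
        · exact ⟨L, hL⟩
        · obtain ⟨c, _, _, hs, _⟩ := hL
          exact absurd hs step_succ_nil
      · have := hl.1
        simp at this
    · obtain ⟨L₁, b₁, rfl, rfl, h₁⟩ := isColored_addStrand.1 hL
      obtain ⟨l', hl'⟩ := IsTangle.of_addStrand hl
      obtain ⟨L', hL'⟩ := h.2 _ _ _ _ hl' h₁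
      exact ⟨_, isColored_addStrand.2 ⟨_, _, rfl, rfl, hL'⟩⟩

theorem isColored_singleton {s : Slice} {a b : List Q} {L : List (List Q)} :
    IsColored [s] a L b ↔ L = [b] ∧ Step s.piece s.pos a b := by
  constructor
  · rintro ⟨c, _, rfl, hs, rfl, rfl⟩; exact ⟨rfl, hs⟩
  · rintro ⟨rfl, hs⟩; exact ⟨_, _, rfl, hs, rfl, rfl⟩

theorem isColored_pair {s t : Slice} {a b : List Q} {L : List (List Q)} :
    IsColored [s, t] a L b ↔
      ∃ c, L = [c, b] ∧ Step s.piece s.pos a c ∧ Step t.piece t.pos c b := by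
  constructor
  · rintro ⟨c, _, rfl, hs, _, _, rfl, ht, rfl, rfl⟩; exact ⟨c, rfl, hs, ht⟩
  · rintro ⟨c, rfl, hs, ht⟩; exact ⟨c, _, rfl, hs, _, _, rfl, ht, rfl, rfl⟩

theorem isColored_triple {s t u : Slice} {a b : List Q} {L : List (List Q)} :
    IsColored [s, t, u] a L b ↔ ∃ c d, L = [c, d, b] ∧ Step s.piece s.pos a c ∧
      Step t.piece t.pos c d ∧ Step u.piece u.pos d b := by
  constructor
  · rintro ⟨c, _, rfl, hs, h⟩
    obtain ⟨d, rfl, ht, hu⟩ := isColored_pair.1 h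
    exact ⟨c, d, rfl, hs, ht, hu⟩
  · rintro ⟨c, d, rfl, hs, ht, hu⟩
    exact ⟨c, _, rfl, hs, isColored_pair.2 ⟨d, rfl, ht, hu⟩⟩

theorem transfers_pair {s t s' t' : Slice}
    (h₁ : ∀ a b c c' : List Q, Step s.piece s.pos a c → Step t.piece t.pos c b →
      Step s.piece s.pos a c' → Step t.piece t.pos c' b → c = c')
    (h₂ : ∀ a b c : List Q, Step s.piece s.pos a c → Step t.piece t.pos c b →
      ∃ c', Step s'.piece s'.pos a c' ∧ Step t'.piece t'.pos c' b) :
    Transfers Q [s, t] [s', t'] := by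
  constructor
  · intro a b L L' h h'
    obtain ⟨c, rfl, hc⟩ := isColored_pair.1 h
    obtain ⟨c', rfl, hc'⟩ := isColored_pair.1 h'
    rw [h₁ a b c c' hc.1 hc.2 hc'.1 hc'.2]
  · intro a b L l _ h
    obtain ⟨c, rfl, hc⟩ := isColored_pair.1 h
    obtain ⟨c', hc'⟩ := h₂ a b c hc.1 hc.2
    exact ⟨_, isColored_pair.2 ⟨c', rfl, hc'⟩⟩

theorem exists_cons_of_lt {α : Type} {k : ℕ} {a : List α} (h : k + 1 ≤ a.length) :
    ∃ x a', a = x :: a' ∧ k ≤ a'.length := by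
  rcases a with _ | ⟨x, a⟩
  · simp at h
  · exact ⟨x, a, rfl, by simpa using h⟩

theorem transfers_exchange (s t : Piece) (d : ℕ) :
    Transfers Q [⟨s, 0⟩, ⟨t, d + s.outs⟩] [⟨t, d + s.ins⟩, ⟨s, 0⟩] ∧
    Transfers Q [⟨t, d + s.ins⟩, ⟨s, 0⟩] [⟨s, 0⟩, ⟨t, d + s.outs⟩] := by
  -- Once the widths of `s` are numerals, `Step` peels off the strands to the left of `t`, which
  -- leaves equations between lists.
  rcases s with _ | _ | _ | _ <;> simp only [Piece.ins, Piece.outs] <;> refine ⟨?_, ?_⟩ <;>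
    apply transfers_pair <;> simp only [Step] <;> grind

theorem transfers_zigzag :
    (Transfers Q [⟨.cup, 1⟩, ⟨.cap, 0⟩] [] ∧ Transfers Q [] [⟨.cup, 1⟩, ⟨.cap, 0⟩]) ∧
    (Transfers Q [⟨.cup, 0⟩, ⟨.cap, 1⟩] [] ∧ Transfers Q [] [⟨.cup, 0⟩, ⟨.cap, 1⟩]) := by
  simp only [Transfers, IsColored, IsTangle, Step, Piece.ins]
  refine ⟨⟨?_, ?_⟩, ?_, ?_⟩
  · grind
  · refine ⟨by grind, ?_⟩
    rintro a _ _ l ⟨h, -⟩ ⟨rfl, rfl⟩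
    -- The zigzag can be inserted only where a strand is present, which the tangle hypothesis
    -- ensures; the new minimum gets the color of that strand.
    obtain ⟨x, a, rfl, -⟩ := exists_cons_of_lt h
    grind
  · grind
  · refine ⟨by grind, ?_⟩
    rintro a _ _ l ⟨-, h, -⟩ ⟨rfl, rfl⟩
    simp only [Piece.outs] at h
    obtain ⟨x, a, rfl, -⟩ := exists_cons_of_lt (k := 0) (a := a) (by omega)
    grind

theorem transfers_slideCap (b : Bool) :
    Transfers Q [⟨.cross b, 0⟩, ⟨.cap, 1⟩] [⟨.cross (!b), 1⟩, ⟨.cap, 0⟩] ∧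
    Transfers Q [⟨.cross (!b), 1⟩, ⟨.cap, 0⟩] [⟨.cross b, 0⟩, ⟨.cap, 1⟩] := by
  refine ⟨?_, ?_⟩ <;> apply transfers_pair <;> cases b <;>
    simp only [Step, Bool.not_true, Bool.not_false]
  · grind
  · grind
  · rintro _ _ _ ⟨p, q, r, rfl, rfl⟩ ⟨x, a, b, e, rfl, y, rfl⟩
    obtain ⟨rfl, rfl, rfl⟩ : q = x ∧ p ◁ q = y ∧ r = y :: b := by simpa using e
    exact ⟨p :: p :: q :: b, by simp [op_op]⟩
  · rintro _ _ _ ⟨p, q, r, rfl, rfl⟩ ⟨x, a, b, e, rfl, y, rfl⟩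
    obtain ⟨rfl, rfl, rfl⟩ : q ◁ p = x ∧ p = y ∧ r = y :: b := by simpa using e
    exact ⟨p :: p :: (q ◁ p) :: b, by simp⟩
  · grind
  · grind
  · rintro _ b _ ⟨x, _, _, rfl, rfl, p, q, r, rfl, rfl⟩ ⟨y, e⟩
    obtain ⟨rfl, rfl, rfl⟩ : x = y ∧ q ◁ p = y ∧ p :: r = b := by simpa using e
    exact ⟨p :: q :: q :: r, by simp [op_op]⟩
  · rintro _ b _ ⟨x, _, _, rfl, rfl, p, q, r, rfl, rfl⟩ ⟨y, e⟩
    obtain ⟨rfl, rfl, rfl⟩ : x = y ∧ q = y ∧ p ◁ q :: r = b := by simpa using e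
    exact ⟨(p ◁ q) :: q :: q :: r, by simp⟩

theorem transfers_slideCup (b : Bool) :
    Transfers Q [⟨.cup, 1⟩, ⟨.cross b, 0⟩] [⟨.cup, 0⟩, ⟨.cross (!b), 1⟩] ∧
    Transfers Q [⟨.cup, 0⟩, ⟨.cross (!b), 1⟩] [⟨.cup, 1⟩, ⟨.cross b, 0⟩] := by
  refine ⟨?_, ?_⟩ <;> apply transfers_pair <;> cases b <;>
    simp only [Step, Bool.not_true, Bool.not_false]
  · grind
  · grind
  · rintro _ _ _ ⟨x, a, _, rfl, rfl, y, rfl⟩ ⟨p, q, r, e, rfl⟩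
    obtain ⟨rfl, rfl, rfl⟩ : x = p ∧ y = q ∧ y :: a = r := by simpa using e
    exact ⟨y :: y :: x :: a, by simp⟩
  · rintro _ _ _ ⟨x, a, _, rfl, rfl, y, rfl⟩ ⟨p, q, r, e, rfl⟩
    obtain ⟨rfl, rfl, rfl⟩ : x = p ∧ y = q ∧ y :: a = r := by simpa using e
    exact ⟨(y ◁ x) :: (y ◁ x) :: x :: a, by simp [op_op]⟩
  · grind
  · grind
  · rintro a _ _ ⟨z, rfl⟩ ⟨x, _, _, e, rfl, p, q, r, rfl, rfl⟩
    obtain ⟨rfl, rfl, rfl⟩ : z = x ∧ z = p ∧ a = q :: r := by simpa using e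
    exact ⟨q :: z :: z :: r, by simp⟩
  · rintro a _ _ ⟨z, rfl⟩ ⟨x, _, _, e, rfl, p, q, r, rfl, rfl⟩
    obtain ⟨rfl, rfl, rfl⟩ : z = x ∧ z = p ∧ a = q :: r := by simpa using e
    exact ⟨q :: (z ◁ q) :: (z ◁ q) :: r, by simp [op_op]⟩

theorem transfers_reidemeisterOneCup (b : Bool) :
    Transfers Q [⟨.cup, 0⟩, ⟨.cross b, 0⟩] [⟨.cup, 0⟩] ∧
    Transfers Q [⟨.cup, 0⟩] [⟨.cup, 0⟩, ⟨.cross b, 0⟩] := by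
  have key (a c : List Q) (h : Step .cup 0 a c) : Step (.cross b) 0 c c := by
    obtain ⟨q, rfl⟩ := h
    cases b
    · exact step_cross_false_zero.2 (by rw [op_self])
    · exact step_cross_true_zero.2 (by rw [op_self])
  have det {a c d : List Q} (h : Step .cup 0 a c) (h' : Step (.cross b) 0 c d) : c = d :=
    (key a c h).eq_of_ne_cup (by simp) h'
  simp only [Transfers, isColored_pair, isColored_singleton]
  refine ⟨⟨?_, ?_⟩, ?_, ?_⟩
  · rintro a d _ _ ⟨c, rfl, h₁, h₂⟩ ⟨c', rfl, h₁', h₂'⟩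
    rw [det h₁ h₂, det h₁' h₂']
  · rintro a d _ _ - ⟨c, rfl, h₁, h₂⟩
    obtain rfl := det h₁ h₂
    exact ⟨_, rfl, h₁⟩
  · rintro a d _ _ ⟨rfl, -⟩ ⟨rfl, -⟩; rfl
  · rintro a d _ _ - ⟨rfl, h⟩
    exact ⟨_, d, rfl, h, key _ _ h⟩

theorem transfers_of_ne_cup {w w' : List Slice} (hw : ∀ s ∈ w, s.piece ≠ .cup)
    (h : ∀ (a b : List Q) (L : List (List Q)) (l : ℕ), IsTangle w' a.length l →
      IsColored w a L b → ∃ L', IsColored w' a L' b) : Transfers Q w w' :=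
  ⟨fun _ _ _ _ h₁ h₂ => (h₁.eq_of_forall_ne_cup hw h₂).1, h⟩

theorem transfers_reidemeisterOneCap (b : Bool) :
    Transfers Q [⟨.cross b, 0⟩, ⟨.cap, 0⟩] [⟨.cap, 0⟩] ∧
    Transfers Q [⟨.cap, 0⟩] [⟨.cross b, 0⟩, ⟨.cap, 0⟩] := by
  refine ⟨transfers_of_ne_cup (by simp) ?_, transfers_of_ne_cup (by simp) ?_⟩ <;>
    simp only [isColored_pair, isColored_singleton]
  · rintro a d _ _ - ⟨c, rfl, h₁, y, rfl⟩
    cases b <;> obtain ⟨p, q, r, rfl, e⟩ := h₁ <;> simp only [List.cons.injEq] at e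
    · obtain ⟨rfl, e, rfl⟩ := e
      -- Here `p ◁ y = y`; applying `◁ y` once more gives `p = y ◁ y = y`.
      rw [← op_op p y, ← e, op_self]
      exact ⟨_, rfl, y, rfl⟩
    · obtain ⟨e, rfl, rfl⟩ := e
      rw [← op_op q y, ← e, op_self]
      exact ⟨_, rfl, y, rfl⟩
  · rintro a d _ _ - ⟨rfl, y, rfl⟩
    refine ⟨_, y :: y :: d, rfl, ?_, y, rfl⟩
    cases b
    · exact step_cross_false_zero.2 (by rw [op_self])
    · exact step_cross_true_zero.2 (by rw [op_self])

theorem transfers_reidemeisterTwo (b : Bool) :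
    Transfers Q [⟨.cross b, 0⟩, ⟨.cross (!b), 0⟩] [] ∧
    Transfers Q [] [⟨.cross b, 0⟩, ⟨.cross (!b), 0⟩] := by
  refine ⟨transfers_of_ne_cup (by simp) ?_, transfers_of_ne_cup (by simp) ?_⟩ <;>
    simp only [isColored_pair]
  · rintro a d _ _ - ⟨c, rfl, h₁, h₂⟩
    refine ⟨[], rfl, ?_⟩
    cases b <;> obtain ⟨p, q, r, rfl, rfl⟩ := h₁
    · rw [step_cross_true_zero.1 h₂, op_op]
    · rw [step_cross_false_zero.1 h₂, op_op]
  · rintro a _ _ l ⟨h, -⟩ ⟨rfl, rfl⟩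
    obtain ⟨x, a, rfl, h'⟩ := exists_cons_of_lt h
    obtain ⟨y, a, rfl, -⟩ := exists_cons_of_lt h'
    cases b
    · exact ⟨_, _, rfl, step_cross_false_zero.2 rfl, step_cross_true_zero.2 (by rw [op_op])⟩
    · exact ⟨_, _, rfl, step_cross_true_zero.2 rfl, step_cross_false_zero.2 (by rw [op_op])⟩

theorem transfers_reidemeisterThree (b : Bool) :
    Transfers Q [⟨.cross b, 0⟩, ⟨.cross b, 1⟩, ⟨.cross b, 0⟩]
      [⟨.cross b, 1⟩, ⟨.cross b, 0⟩, ⟨.cross b, 1⟩] ∧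
    Transfers Q [⟨.cross b, 1⟩, ⟨.cross b, 0⟩, ⟨.cross b, 1⟩]
      [⟨.cross b, 0⟩, ⟨.cross b, 1⟩, ⟨.cross b, 0⟩] := by
  refine ⟨transfers_of_ne_cup (by simp) ?_, transfers_of_ne_cup (by simp) ?_⟩ <;>
    simp only [isColored_triple]
  · rintro a _ _ _ - ⟨c, d, rfl, h₁, ⟨x, b', d, rfl, rfl, h₂⟩, h₃⟩
    cases b
    · obtain ⟨p, q, r, rfl, e⟩ := h₁
      obtain ⟨p', q', r', rfl, rfl⟩ := h₂
      obtain ⟨rfl, rfl, rfl⟩ : x = q ∧ p' = p ◁ q ∧ q' :: r' = r := by simpa using e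
      obtain rfl := step_cross_false_zero.1 h₃
      exact ⟨_, p :: q' :: (x ◁ q') :: r', q' :: (p ◁ q') :: (x ◁ q') :: r', rfl,
        step_succ_cons.2 ⟨_, rfl, step_cross_false_zero.2 rfl⟩, step_cross_false_zero.2 rfl,
        step_succ_cons.2 ⟨_, rfl, step_cross_false_zero.2 (by rw [← op_distrib])⟩⟩
    · obtain ⟨p, q, r, rfl, e⟩ := h₁
      obtain ⟨p', q', r', rfl, rfl⟩ := h₂
      obtain ⟨rfl, rfl, rfl⟩ : x = q ◁ p ∧ p' = p ∧ q' :: r' = r := by simpa using e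
      obtain rfl := step_cross_true_zero.1 h₃
      exact ⟨_, p' :: (q' ◁ q) :: q :: r', ((q' ◁ q) ◁ p') :: p' :: q :: r', rfl,
        step_succ_cons.2 ⟨_, rfl, step_cross_true_zero.2 rfl⟩, step_cross_true_zero.2 rfl,
        step_succ_cons.2 ⟨_, by rw [← op_distrib], step_cross_true_zero.2 rfl⟩⟩
  · rintro a _ _ _ - ⟨_, d, rfl, ⟨x, a, c, rfl, rfl, h₁⟩, h₂, h₃⟩
    cases b
    · obtain ⟨p, q, r, rfl, rfl⟩ := h₁
      obtain rfl := step_cross_false_zero.1 h₂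
      obtain ⟨b, rfl, h₄⟩ := step_succ_cons.1 h₃
      obtain rfl := step_cross_false_zero.1 h₄
      exact ⟨_, p :: (x ◁ p) :: q :: r, p :: q :: ((x ◁ p) ◁ q) :: r, rfl,
        step_cross_false_zero.2 rfl, step_succ_cons.2 ⟨_, rfl, step_cross_false_zero.2 rfl⟩,
        step_cross_false_zero.2 (by rw [op_distrib x p q])⟩
    · obtain ⟨p, q, r, rfl, rfl⟩ := h₁
      obtain rfl := step_cross_true_zero.1 h₂
      obtain ⟨b, rfl, h₄⟩ := step_succ_cons.1 h₃
      obtain rfl := step_cross_true_zero.1 h₄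
      exact ⟨_, (p ◁ x) :: x :: q :: r, (p ◁ x) :: (q ◁ x) :: x :: r, rfl,
        step_cross_true_zero.2 rfl, step_succ_cons.2 ⟨_, rfl, step_cross_true_zero.2 rfl⟩,
        step_cross_true_zero.2 (by rw [op_distrib q p x])⟩

/-- Idempotence answers to the first Reidemeister move, involutivity to the second and to the slides
over extrema, self-distributivity to the third. -/
theorem _root_.LocalMove.transfers {w w' : List Slice} (h : LocalMove w w') :
    Transfers Q w w' ∧ Transfers Q w' w := by
  have lift {w w' : List Slice} (h : Transfers Q w w' ∧ Transfers Q w' w) :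
      Transfers Q (addStrand w) (addStrand w') ∧ Transfers Q (addStrand w') (addStrand w) :=
    ⟨h.1.addStrand, h.2.addStrand⟩
  rcases h with ⟨s, t, i, d⟩ | i | i | ⟨b, i⟩ | ⟨b, i⟩ | ⟨b, i⟩ | ⟨b, i⟩ | ⟨b, i⟩ | ⟨b, i⟩ <;>
    induction i with
    | zero => ?_
    | succ i ih => ?_
  · have := transfers_exchange (Q := Q) s t d
    simpa only [Nat.zero_add, Nat.add_comm] using this
  · have e (n : ℕ) : i + 1 + n + d = i + n + d + 1 := by omega
    simp only [e]
    exact lift ih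
  · exact transfers_zigzag.1
  · exact lift ih
  · exact transfers_zigzag.2
  · exact lift ih
  · exact transfers_slideCap b
  · exact lift ih
  · exact transfers_slideCup b
  · exact lift ih
  · exact transfers_reidemeisterOneCup b
  · exact lift ih
  · exact transfers_reidemeisterOneCap b
  · exact lift ih
  · exact transfers_reidemeisterTwo b
  · exact lift ih
  · exact transfers_reidemeisterThree b
  · exact lift ih

theorem _root_.IsTangle.exists_of_append {u v : List Slice} {k l : ℕ}
    (h : IsTangle (u ++ v) k l) : ∃ m, IsTangle u k m ∧ IsTangle v m l := by
  induction u generalizing k with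
  | nil => exact ⟨k, rfl, h⟩
  | cons s u ih =>
    obtain ⟨m, h₁, h₂⟩ := ih h.2
    exact ⟨m, ⟨h.1, h₁⟩, h₂⟩

theorem _root_.IsTangle.unique {u : List Slice} {k l m : ℕ} (h : IsTangle u k l)
    (h' : IsTangle u k m) : l = m := by
  induction u generalizing k with
  | nil => exact h.symm.trans h'
  | cons s u ih => exact ih h.2 h'.2

/-! ### Natural bijections between colorings of equivalent diagrams -/

/-- The colorings of the diagram `D` by `Q`, given by the colors on its levels. -/
def Coloring (D : LinkDiagram) (Q : Type) [Kei Q] : Type :=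
  {L : List (List Q) // IsColored D.word [] L []}

/-- The image of a coloring under a homomorphism. -/
def Coloring.map {D : LinkDiagram} (φ : Q → R) (hφ : IsHom φ) (c : Coloring D Q) :
    Coloring D R :=
  ⟨c.1.map (List.map φ), c.2.map hφ⟩

/-- The colorings `L` of `u ++ w ++ v` and `L'` of `u ++ w' ++ v` agree outside of `w` and `w'`. -/
def Agree (u w w' v : List Slice) (L L' : List (List Q)) : Prop :=
  ∃ L₁ M M' L₂ a b, L = L₁ ++ M ++ L₂ ∧ L' = L₁ ++ M' ++ L₂ ∧
    IsColored u [] L₁ a ∧ IsColored w a M b ∧ IsColored w' a M' b ∧ IsColored v b L₂ []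

theorem Agree.symm {u w w' v : List Slice} {L L' : List (List Q)} (h : Agree u w w' v L L') :
    Agree u w' w v L' L := by
  obtain ⟨L₁, M, M', L₂, a, b, h₁, h₂, h₃, h₄, h₅, h₆⟩ := h
  exact ⟨L₁, M', M, L₂, a, b, h₂, h₁, h₃, h₅, h₄, h₆⟩

theorem Agree.map {φ : Q → R} (hφ : IsHom φ) {u w w' v : List Slice} {L L' : List (List Q)}
    (h : Agree u w w' v L L') :
    Agree u w w' v (L.map (List.map φ)) (L'.map (List.map φ)) := by
  obtain ⟨L₁, M, M', L₂, a, b, rfl, rfl, h₃, h₄, h₅, h₆⟩ := h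
  exact ⟨_, _, _, _, _, _, by simp only [List.map_append], by simp only [List.map_append],
    h₃.map hφ, h₄.map hφ, h₅.map hφ, h₆.map hφ⟩

theorem IsColored.append_unique {u v : List Slice} {a b b' c c' : List Q}
    {L₁ L₂ L₁' L₂' : List (List Q)} (h₁ : IsColored u a L₁ b) (_ : IsColored v b L₂ c)
    (h₁' : IsColored u a L₁' b') (_ : IsColored v b' L₂' c') (h : L₁ ++ L₂ = L₁' ++ L₂') :
    L₁ = L₁' ∧ L₂ = L₂' ∧ b = b' := by
  obtain ⟨rfl, rfl⟩ := List.append_inj h (by rw [h₁.length_levels, h₁'.length_levels])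
  refine ⟨rfl, rfl, ?_⟩
  clear h
  induction u generalizing a L₁ with
  | nil => exact h₁.2.symm.trans h₁'.2
  | cons s u ih =>
    obtain ⟨d, L, rfl, -, h₁⟩ := h₁
    obtain ⟨d', L', e, -, h₁'⟩ := h₁'
    obtain ⟨rfl, rfl⟩ : d = d' ∧ L = L' := by simpa using e
    exact ih h₁ h₁'

/-- The levels outside the moved part fix the colors at its two ends, and these determine the
coloring inside. -/
theorem Agree.unique {u w w' v : List Slice} (h : Transfers Q w' w) {L L' L'' : List (List Q)}
    (h₁ : Agree u w w' v L L') (h₂ : Agree u w w' v L L'') : L' = L'' := by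
  obtain ⟨L₁, M, M', L₂, a, b, rfl, rfl, hu, hw, hw', hv⟩ := h₁
  obtain ⟨N₁, N, N', N₂, a', b', e, rfl, ku, kw, kw', kv⟩ := h₂
  simp only [List.append_assoc] at e
  obtain ⟨rfl, e, rfl⟩ := hu.append_unique (hw.append hv) ku (kw.append kv) e
  obtain ⟨rfl, rfl, rfl⟩ := hw.append_unique hv kw kv e
  rw [h.1 _ _ _ _ hw' kw']

theorem exists_agree {u w w' v : List Slice} (h : Transfers Q w w')
    (hD : IsTangle (u ++ w' ++ v) 0 0) {L : List (List Q)}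
    (hL : IsColored (u ++ w ++ v) [] L []) : ∃ L', Agree u w w' v L L' := by
  obtain ⟨_, L₂, b, rfl, h₁, hv⟩ := isColored_append.1 hL
  obtain ⟨L₁, M, a, rfl, hu, hw⟩ := isColored_append.1 h₁
  obtain ⟨m, hm, -⟩ := hD.exists_of_append
  obtain ⟨k, hk, hkm⟩ := hm.exists_of_append
  obtain rfl := hu.isTangle.unique hk
  obtain ⟨M', hM'⟩ := h.2 _ _ _ _ hkm hw
  exact ⟨_, L₁, M, M', L₂, a, b, rfl, rfl, hu, hw, hM', hv⟩

theorem Agree.isColored {u w w' v : List Slice} {L L' : List (List Q)}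
    (h : Agree u w w' v L L') : IsColored (u ++ w' ++ v) [] L' [] := by
  obtain ⟨L₁, M, M', L₂, a, b, rfl, rfl, hu, hw, hw', hv⟩ := h
  exact (hu.append hw').append hv

/-- The colorings of `D` and `D'` correspond to each other, naturally in the quandle. -/
def Equivalent (D D' : LinkDiagram) : Prop :=
  ∃ e : ∀ (Q : Type) [Kei Q], Coloring D Q ≃ Coloring D' Q,
    ∀ (Q R : Type) [Kei Q] [Kei R] (φ : Q → R) (hφ : IsHom φ) (c : Coloring D Q),
      e R (c.map φ hφ) = (e Q c).map φ hφ

theorem Equivalent.symm {D D' : LinkDiagram} (h : Equivalent D D') : Equivalent D' D := by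
  obtain ⟨e, he⟩ := h
  refine ⟨fun Q _ => (e Q).symm, fun Q R _ _ φ hφ c => ?_⟩
  rw [Equiv.symm_apply_eq, he, Equiv.apply_symm_apply]

theorem Equivalent.trans {D D' D'' : LinkDiagram} (h : Equivalent D D')
    (h' : Equivalent D' D'') : Equivalent D D'' := by
  obtain ⟨e, he⟩ := h
  obtain ⟨e', he'⟩ := h'
  exact ⟨fun Q _ => (e Q).trans (e' Q), fun Q R _ _ φ hφ c => by
    simp only [Equiv.trans_apply, he, he']⟩

/-- Agreement outside the moved part is a one-to-one relation. A homomorphism maps agreeing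
colorings to agreeing ones, so naturality follows from uniqueness. -/
theorem _root_.LinkDiagram.Move.equivalent {D D' : LinkDiagram} (h : D.Move D') :
    Equivalent D D' := by
  obtain ⟨u, v, w, w', hw, hD, hD'⟩ := h
  obtain ⟨_, closed⟩ := D
  obtain ⟨_, closed'⟩ := D'
  simp only at hD hD'
  subst hD hD'
  have key (Q : Type) [Kei Q] := hw.transfers (Q := Q)
  have ex (Q : Type) [Kei Q] (c : Coloring ⟨_, closed⟩ Q) :
      ∃ c' : Coloring ⟨_, closed'⟩ Q, Agree u w w' v c.1 c'.1 := by
    obtain ⟨L', hL'⟩ := exists_agree (key Q).1 closed' c.2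
    exact ⟨⟨L', hL'.isColored⟩, hL'⟩
  have ex' (Q : Type) [Kei Q] (c : Coloring ⟨_, closed'⟩ Q) :
      ∃ c' : Coloring ⟨_, closed⟩ Q, Agree u w w' v c'.1 c.1 := by
    obtain ⟨L', hL'⟩ := exists_agree (key Q).2 closed c.2
    exact ⟨⟨L', hL'.isColored⟩, hL'.symm⟩
  choose f hf using ex
  choose g hg using ex'
  refine ⟨fun Q _ => ⟨f Q, g Q, fun c => ?_, fun c => ?_⟩, fun Q R _ _ φ hφ c => ?_⟩
  · exact Subtype.ext ((hg Q (f Q c)).symm.unique (key Q).1 (hf Q c).symm)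
  · exact Subtype.ext ((hf Q (g Q c)).unique (key Q).2 (hg Q c))
  · exact Subtype.ext ((hf R (c.map φ hφ)).unique (key R).2 ((hf Q c).map hφ))

theorem equivalent_of_link_eq {D D' : LinkDiagram} (h : D.link = D'.link) : Equivalent D D' := by
  have h' := Quot.eqvGen_exact h
  clear h
  induction h' with
  | rel _ _ h => exact h.equivalent
  | refl _ => exact ⟨fun Q _ => Equiv.refl _, fun Q R _ _ φ hφ c => rfl⟩
  | symm _ _ _ ih => exact ih.symm
  | trans _ _ _ _ _ ih ih' => exact ih.trans ih'

/-! ### Constant colorings -/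

/-- A coloring is constant if it uses at most one color. -/
def Coloring.IsConst {D : LinkDiagram} (c : Coloring D Q) (q : Q) : Prop :=
  ∀ l ∈ c.1, ∀ x ∈ l, x = q

instance : Kei Unit := ⟨fun _ _ => (), fun _ => rfl, fun _ _ => rfl, fun _ _ _ => rfl⟩

theorem IsColored.unit_unique {w : List Slice} {a b b' : List Unit} {L L' : List (List Unit)}
    (h : IsColored w a L b) (h' : IsColored w a L' b') : L = L' := by
  induction w generalizing a L L' with
  | nil => exact h.1.trans h'.1.symm
  | cons s w ih =>
    obtain ⟨c, L, rfl, hs, h⟩ := h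
    obtain ⟨c', L', rfl, hs', h'⟩ := h'
    obtain rfl : c = c' := List.ext_getElem (hs.length.2.trans hs'.length.2.symm)
      fun _ _ _ => rfl
    rw [ih h h']

theorem exists_step (q : Q) {s : Piece} {i k : ℕ} (h : i + s.ins ≤ k) :
    Step s i (List.replicate k q) (List.replicate (k - s.ins + s.outs) q) := by
  induction i generalizing k with
  | zero =>
    obtain ⟨k, rfl⟩ := Nat.exists_eq_add_of_le' h
    rcases s with _ | _ | _ | _ <;>
      simp [Step, Piece.ins, Piece.outs, List.replicate_succ, op_self]
  | succ i ih =>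
    obtain ⟨k, rfl⟩ := Nat.exists_eq_add_of_le' (show 1 ≤ k by omega)
    have e : k + 1 - s.ins + s.outs = k - s.ins + s.outs + 1 := by omega
    rw [e]
    exact ⟨q, _, _, rfl, rfl, ih (by omega)⟩

theorem exists_isColored_const (q : Q) {w : List Slice} {k l : ℕ} (h : IsTangle w k l) :
    ∃ L, IsColored w (List.replicate k q) L (List.replicate l q) ∧ ∀ a ∈ L, ∀ x ∈ a, x = q := by
  induction w generalizing k with
  | nil => obtain rfl := h; exact ⟨[], ⟨rfl, rfl⟩, by simp⟩
  | cons s w ih =>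
    obtain ⟨L, hL, hc⟩ := ih h.2
    refine ⟨_, ⟨_, L, rfl, exists_step q h.1, hL⟩, ?_⟩
    simp only [List.mem_cons, forall_eq_or_imp]
    exact ⟨fun x hx => List.eq_of_mem_replicate hx, hc⟩

/-- A constant coloring factors through the one-point quandle, whose coloring is unique because the
word fixes the length of each level. -/
theorem Coloring.eq_of_isConst {D : LinkDiagram} {c c' : Coloring D Q} {q : Q} (h : c.IsConst q)
    (h' : c'.IsConst q) : c = c' := by
  have key {c : Coloring D Q} (h : c.IsConst q) :
      c = (c.map (fun _ => ()) (isHom_const ())).map (fun _ => q) (isHom_const q) := by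
    refine Subtype.ext ?_
    simp only [Coloring.map, List.map_map]
    refine (List.map_id _).symm.trans (List.map_congr_left fun l hl => ?_)
    simp only [id, Function.comp, List.map_map]
    exact (List.map_id _).symm.trans (List.map_congr_left fun x hx => h l hl x hx)
  rw [key h, key h']
  congr 1
  exact Subtype.ext ((c.map _ (isHom_const ())).2.unit_unique (c'.map _ (isHom_const ())).2)

theorem Coloring.isConst_map {D : LinkDiagram} (c : Coloring D Q) (q : R) :
    (c.map (fun _ => q) (isHom_const q)).IsConst q := by
  intro l hl x hx
  obtain ⟨l', -, rfl⟩ := List.mem_map.1 hl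
  obtain ⟨-, -, rfl⟩ := List.mem_map.1 hx
  rfl

/-- A coloring is constant with value `q` exactly when it equals its own image under the constant
map to `q`, and this condition is natural. -/
theorem Coloring.isConst_apply_iff {D D' : LinkDiagram}
    (e : ∀ (Q : Type) [Kei Q], Coloring D Q ≃ Coloring D' Q)
    (he : ∀ (Q R : Type) [Kei Q] [Kei R] (φ : Q → R) (hφ : IsHom φ) (c : Coloring D Q),
      e R (c.map φ hφ) = (e Q c).map φ hφ) (c : Coloring D Q) (q : Q) :
    (e Q c).IsConst q ↔ c.IsConst q := by
  have h := he Q Q _ (isHom_const q) c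
  constructor
  · intro hc
    have : c = c.map (fun _ => q) (isHom_const q) :=
      (e Q).injective (h ▸ eq_of_isConst hc (isConst_map _ q))
    rw [this]
    exact isConst_map _ q
  · intro hc
    rw [eq_of_isConst hc (isConst_map c q), h]
    exact isConst_map _ q

/-! ### From colors on levels to colors on arcs -/

theorem IsColored.step {w : List Slice} {a b : List Q} {L : List (List Q)}
    (h : IsColored w a L b) {t : ℕ} {s : Slice} (ht : w[t]? = some s) :
    Step s.piece s.pos ((a :: L).getD t []) ((a :: L).getD (t + 1) []) := by
  induction w generalizing a L t with
  | nil => simp at ht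
  | cons s' w ih =>
    obtain ⟨c, L, rfl, hs, h⟩ := h
    cases t with
    | zero =>
      obtain rfl : s' = s := by simpa using ht
      simpa using hs
    | succ t =>
      simp only [List.getElem?_cons_succ] at ht
      simpa using ih h ht

theorem IsColored.length_getD {w : List Slice} {a b : List Q} {L : List (List Q)}
    (h : IsColored w a L b) {t : ℕ} (ht : t ≤ w.length) :
    (w.take t).foldl (fun k s => k - s.piece.ins + s.piece.outs) a.length =
      ((a :: L).getD t []).length := by
  induction w generalizing a L t with
  | nil => obtain rfl : t = 0 := by simpa using ht
           simp
  | cons s w ih =>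
    obtain ⟨c, L, rfl, hs, h⟩ := h
    cases t with
    | zero => simp
    | succ t =>
      have := ih h (t := t) (by simpa using ht)
      rw [hs.length.2] at this
      simpa using this

theorem Step.getElem?_left {s : Piece} {i : ℕ} {a b : List Q} (h : Step s i a b) {j : ℕ}
    (hj : j < i) : a[j]? = b[j]? := by
  induction i generalizing a b j with
  | zero => simp at hj
  | succ i ih =>
    obtain ⟨x, a, b, rfl, rfl, h⟩ := h
    cases j with
    | zero => simp
    | succ j => simpa using ih h (by simpa using hj)

theorem Step.getElem?_right {s : Piece} {i : ℕ} {a b : List Q} (h : Step s i a b) (j : ℕ) :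
    a[i + s.ins + j]? = b[i + s.outs + j]? := by
  induction i generalizing a b with
  | zero =>
    rcases s with _ | _ | _ | _ <;> simp only [Step] at h
    · obtain ⟨q, rfl⟩ := h; simp [Piece.ins, Piece.outs, Nat.add_comm 2]
    · obtain ⟨q, rfl⟩ := h; simp [Piece.ins, Piece.outs, Nat.add_comm 2]
    · obtain ⟨p, q, r, rfl, rfl⟩ := h; simp [Piece.ins, Piece.outs, Nat.add_comm 2]
    · obtain ⟨p, q, r, rfl, rfl⟩ := h; simp [Piece.ins, Piece.outs, Nat.add_comm 2]
  | succ i ih =>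
    obtain ⟨x, a, b, rfl, rfl, h⟩ := h
    have e (n : ℕ) : i + 1 + n + j = i + n + j + 1 := by omega
    simpa [e] using ih h

theorem Step.getElem?_cup {i : ℕ} {a b : List Q} (h : Step .cup i a b) :
    b[i]? = b[i + 1]? := by
  induction i generalizing a b with
  | zero => obtain ⟨q, rfl⟩ := h; simp
  | succ i ih =>
    obtain ⟨x, a, b, rfl, rfl, h⟩ := h
    simpa using ih h

theorem Step.getElem?_cap {i : ℕ} {a b : List Q} (h : Step .cap i a b) :
    a[i]? = a[i + 1]? := by
  induction i generalizing a b with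
  | zero => obtain ⟨q, rfl⟩ := h; simp
  | succ i ih =>
    obtain ⟨x, a, b, rfl, rfl, h⟩ := h
    simpa using ih h

theorem Step.getElem?_cross_true {i : ℕ} {a b : List Q} (h : Step (.cross true) i a b) :
    ∃ p q, a[i]? = some p ∧ a[i + 1]? = some q ∧ b[i]? = some (q ◁ p) ∧ b[i + 1]? = some p := by
  induction i generalizing a b with
  | zero => obtain ⟨p, q, r, rfl, rfl⟩ := h; exact ⟨p, q, by simp⟩
  | succ i ih =>
    obtain ⟨x, a, b, rfl, rfl, h⟩ := h
    simpa using ih h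

theorem Step.getElem?_cross_false {i : ℕ} {a b : List Q} (h : Step (.cross false) i a b) :
    ∃ p q, a[i]? = some p ∧ a[i + 1]? = some q ∧ b[i]? = some q ∧ b[i + 1]? = some (p ◁ q) := by
  induction i generalizing a b with
  | zero => obtain ⟨p, q, r, rfl, rfl⟩ := h; exact ⟨p, q, by simp⟩
  | succ i ih =>
    obtain ⟨x, a, b, rfl, rfl, h⟩ := h
    simpa using ih h

/-- The color at a point of the diagram. -/
def Coloring.color [Inhabited Q] {D : LinkDiagram} (c : Coloring D Q) (p : ℕ × ℕ) : Q :=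
  (([] :: c.1).getD p.1 [])[p.2]?.getD default

theorem Coloring.color_eq_of_sliceJoined [Inhabited Q] {D : LinkDiagram} (c : Coloring D Q)
    {p q : ℕ × ℕ} (h : SliceJoined D.word p q) : c.color p = c.color q := by
  unfold color
  cases h with
  | left t j s ht hj => rw [(c.2.step ht).getElem?_left hj]
  | right t j s ht => rw [(c.2.step ht).getElem?_right j]
  | cup t i ht => rw [(c.2.step ht).getElem?_cup]
  | cap t i ht => rw [(c.2.step ht).getElem?_cap]
  | overTrue t i ht =>
    obtain ⟨p, q, h₁, h₂, h₃, h₄⟩ := (c.2.step ht).getElem?_cross_true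
    rw [h₁, h₄]
  | overFalse t i ht =>
    obtain ⟨p, q, h₁, h₂, h₃, h₄⟩ := (c.2.step ht).getElem?_cross_false
    rw [h₂, h₃]

theorem Coloring.color_crossing [Inhabited Q] {D : LinkDiagram} (c : Coloring D Q)
    {o u v : ℕ × ℕ} (h : CrossingAt D.word o u v) : c.color v = c.color u ◁ c.color o := by
  unfold color
  cases h with
  | crossTrue t i ht =>
    obtain ⟨p, q, h₁, h₂, h₃, h₄⟩ := (c.2.step ht).getElem?_cross_true
    simp only [h₁, h₂, h₃, Option.getD_some]
  | crossFalse t i ht =>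
    obtain ⟨p, q, h₁, h₂, h₃, h₄⟩ := (c.2.step ht).getElem?_cross_false
    simp only [h₁, h₂, h₄, Option.getD_some]

/-- The color of an arc. -/
def Coloring.arcColor [Inhabited Q] {D : LinkDiagram} (c : Coloring D Q) : D.Arc → Q :=
  Quot.lift (fun p => c.color p.1) fun _ _ h => c.color_eq_of_sliceJoined h

theorem Coloring.arcColor_crossing [Inhabited Q] {D : LinkDiagram} (c : Coloring D Q)
    (x : D.Crossing) :
    c.arcColor (D.under₂ x) = c.arcColor (D.under₁ x) ◁ c.arcColor (D.over x) :=
  c.color_crossing x.2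

theorem Coloring.exists_arcColor_eq [Inhabited Q] {D : LinkDiagram} (c : Coloring D Q)
    {l : List Q} (hl : l ∈ c.1) {x : Q} (hx : x ∈ l) : ∃ a : D.Arc, c.arcColor a = x := by
  obtain ⟨t, ht, rfl⟩ := List.getElem_of_mem hl
  obtain ⟨j, hj, rfl⟩ := List.getElem_of_mem hx
  have hlen := c.2.length_levels
  -- The list of levels omits the empty bottom line, hence the shift by one.
  refine ⟨D.arc ⟨(t + 1, j), by simp only; omega, ?_⟩, ?_⟩
  · have := c.2.length_getD (t := t + 1) (by omega)
    simp only [width]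
    rw [List.length_nil] at this
    rw [this]
    simpa [List.getElem?_eq_getElem ht] using hj
  · show c.color (t + 1, j) = _
    simp [color, List.getElem?_eq_getElem ht, List.getElem?_eq_getElem hj]

theorem Coloring.arcColor_mem [Inhabited Q] {D : LinkDiagram} (c : Coloring D Q)
    (a : D.Arc) : ∃ l ∈ c.1, c.arcColor a ∈ l := by
  induction a using Quot.ind with
  | mk p =>
  obtain ⟨⟨t, j⟩, ht, hj⟩ := p
  simp only at ht hj
  have h := c.2.length_getD ht
  simp only [width] at hj
  rw [List.length_nil] at h
  rw [h] at hj
  show ∃ l ∈ c.1, c.color (t, j) ∈ l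
  cases t with
  | zero => simp at hj
  | succ t =>
    rw [← c.2.length_levels] at ht
    simp only [List.getD_cons_succ, List.getD_eq_getElem _ _ ht] at hj
    refine ⟨c.1[t], List.getElem_mem _, ?_⟩
    simp [color, List.getElem?_eq_getElem ht, List.getElem?_eq_getElem hj]

theorem Coloring.exists_arcColor_ne [Inhabited Q] {D : LinkDiagram} (c : Coloring D Q)
    (hc : ∀ q, ¬ c.IsConst q) : ∃ a b : D.Arc, c.arcColor a ≠ c.arcColor b := by
  by_contra! h
  by_cases hD : Nonempty D.Arc
  · obtain ⟨a⟩ := hD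
    refine hc (c.arcColor a) fun l hl x hx => ?_
    obtain ⟨b, rfl⟩ := c.exists_arcColor_eq hl hx
    exact h b a
  · refine hc default fun l hl x hx => ?_
    obtain ⟨b, rfl⟩ := c.exists_arcColor_eq hl hx
    exact absurd ⟨b⟩ hD

/-! ### Fox colorings and the determinant -/

/-- The involutory quandle of Fox colorings by elements of a ring. -/
abbrev fox (R : Type) [CommRing R] : Kei R where
  op x y := 2 * y - x
  op_self x := by ring
  op_op x y := by ring
  op_distrib x y z := by ring

instance : Kei ℤ := fox ℤ

instance (m : ℕ) : Kei (ZMod m) := fox (ZMod m)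

theorem isHom_intCast (m : ℕ) : IsHom (Int.cast : ℤ → ZMod m) := fun x y => by
  show ((2 * y - x : ℤ) : ZMod m) = 2 * y - x
  push_cast
  rfl

theorem Coloring.isNontrivialColoring {D : LinkDiagram} {m : ℕ} (c : Coloring D (ZMod m))
    (hc : ∀ q, ¬ c.IsConst q) : D.IsNontrivialColoring m c.arcColor := by
  refine ⟨fun x => ?_, c.exists_arcColor_ne hc⟩
  have h : _ = 2 * c.arcColor (D.over x) - c.arcColor (D.under₁ x) := c.arcColor_crossing x
  rw [h]
  ring

instance (D : LinkDiagram) : Finite D.Point := by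
  let k := (Finset.range (D.word.length + 1)).sup fun t => width (D.word.take t)
  refine Finite.of_injective
    (fun p : D.Point => ((⟨p.1.1, Nat.lt_succ_of_le p.2.1⟩, ⟨p.1.2, ?_⟩) :
      Fin (D.word.length + 1) × Fin k)) ?_
  · exact p.2.2.trans_le (Finset.le_sup (f := fun t => width (D.word.take t))
      (Finset.mem_range.2 (Nat.lt_succ_of_le p.2.1)))
  · intro p q h
    simp only [Prod.mk.injEq, Fin.mk.injEq] at h
    exact Subtype.ext (Prod.ext h.1 h.2)

instance (D : LinkDiagram) : Finite D.Arc := Quot.finite _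

open Classical in
-- Constants lie in the kernel of the coloring matrix, so a non-constant coloring can be shifted to
-- vanish on the one omitted column. What remains is a non-zero kernel vector of the submatrix. A
-- repeated column makes the minor vanish anyway.
theorem Coloring.det_eq_zero {D : LinkDiagram} (c : Coloring D ℤ) (hc : ∀ q, ¬ c.IsConst q) :
    D.det = 0 := by
  have hI : D.minorIdeal = ⊥ := by
    refine Ideal.span_eq_bot.2 ?_
    rintro _ ⟨r, s, rfl⟩
    by_cases hs : Function.Injective s
    · obtain ⟨a, b, hab⟩ := c.exists_arcColor_ne hc
      have : Fintype D.Arc := Fintype.ofFinite _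
      have hns : ¬ Function.Surjective s := by
        intro h
        have e := Nat.card_congr (Equiv.ofBijective s ⟨hs, h⟩)
        have : 0 < Nat.card D.Arc := Nat.card_pos_iff.2 ⟨⟨a⟩, inferInstance⟩
        rw [Nat.card_fin] at e
        omega
      simp only [Function.Surjective, not_forall, not_exists] at hns
      obtain ⟨d, hd⟩ := hns
      -- By counting, `N - 1` distinct columns miss only the arc `d`.
      have hcov (e : D.Arc) : e = d ∨ ∃ i, s i = e := by
        by_contra! h
        have h₁ : Finset.univ.image s ⊆ (Finset.univ.erase d).erase e := by
          intro x hx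
          obtain ⟨i, -, rfl⟩ := Finset.mem_image.1 hx
          simp [h.2 i, hd i]
        have h₂ := Finset.card_le_card h₁
        rw [Finset.card_image_of_injective _ hs, Finset.card_erase_of_mem (by simp [h.1]),
          Finset.card_erase_of_mem (by simp), Finset.card_univ, Finset.card_univ, Fintype.card_fin,
          Nat.card_eq_fintype_card] at h₂
        have : 1 < Fintype.card D.Arc := Fintype.one_lt_card_iff.2 ⟨e, d, h.1⟩
        omega
      refine Matrix.exists_mulVec_eq_zero_iff.1
        ⟨fun i => c.arcColor (s i) - c.arcColor d, fun h0 => hab ?_, funext fun i => ?_⟩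
      · have key (e : D.Arc) : c.arcColor e = c.arcColor d := by
          rcases hcov e with rfl | ⟨i, rfl⟩
          · rfl
          · exact sub_eq_zero.1 (congrFun h0 i)
        rw [key a, key b]
      · have h₁ : ∑ j, D.coloringMatrix (r i) (s j) * (c.arcColor (s j) - c.arcColor d) =
            ∑ e, D.coloringMatrix (r i) e * (c.arcColor e - c.arcColor d) := by
          rw [← Finset.sum_image (f := fun e => D.coloringMatrix (r i) e *
            (c.arcColor e - c.arcColor d)) (fun x _ y _ h => hs h)]
          refine Finset.sum_subset (Finset.subset_univ _) fun e _ he => ?_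
          rcases hcov e with rfl | ⟨i, rfl⟩
          · simp
          · simp at he
        have h₂ : _ = 2 * c.arcColor (D.over (r i)) - c.arcColor (D.under₁ (r i)) :=
          c.arcColor_crossing (r i)
        show ∑ j, D.coloringMatrix (r i) (s j) * (c.arcColor (s j) - c.arcColor d) = 0
        rw [h₁]
        simp only [LinkDiagram.coloringMatrix, Matrix.of_apply, sub_mul, mul_assoc, ite_mul,
          one_mul, zero_mul, Finset.sum_sub_distrib, ← Finset.mul_sum, Finset.sum_ite_eq',
          Finset.mem_univ, if_true, h₂]
        ring
    · simp only [Function.Injective, not_forall] at hs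
      obtain ⟨i, j, hij, hne⟩ := hs
      exact Matrix.det_zero_of_column_eq hne fun k => by simp [hij]
  rw [LinkDiagram.det, (Submodule.IsPrincipal.eq_bot_iff_generator_eq_zero _).1 hI,
    Int.natAbs_zero]

/-! ## Split links -/

/-- Triples `(f, g, a)`, on which passing under `(f', g', a')` changes `a` by the term
`(f + f') g g'`. The pairs `(f, g)` mark the components of a link, and such marks extend to a
coloring if each component has even linking number with the appropriate others. -/
@[ext]
structure Marked : Type where
  f : Bool
  g : Bool
  a : Bool

instance : Kei Bool := ⟨fun x _ => x, fun _ => rfl, fun _ _ => rfl, fun _ _ _ => rfl⟩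

instance : Kei Marked where
  op x y := ⟨x.f, x.g, xor x.a (xor x.f y.f && x.g && y.g)⟩
  op_self x := by simp
  op_op x y := by simp
  op_distrib x y z := by
    ext1
    · rfl
    · rfl
    · exact Bool.xor_right_comm _ _ _

theorem Marked.isHom_f : IsHom Marked.f := fun _ _ => rfl

theorem Marked.isHom_g : IsHom Marked.g := fun _ _ => rfl

/-- Between elements with equal first mark the correction term vanishes, so the last entry can stay
`false`. -/
theorem Marked.isHom_mk (b : Bool) : IsHom (fun x => Marked.mk b x false) :=
  fun x y => by simp [op]

/-- The components of the diagram fall into two classes, marked by `f`, such that no component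
links with a component of the other class. -/
def Separable (D : LinkDiagram) : Prop :=
  ∃ f : Coloring D Bool, (∀ q, ¬ f.IsConst q) ∧ ∀ g : Coloring D Bool,
    ∃ c : Coloring D Marked, c.map _ Marked.isHom_f = f ∧ c.map _ Marked.isHom_g = g

/-- Naturality with respect to the two projections transports the lifts; bijectivity ensures that
every second marking is reached. -/
theorem Separable.of_equivalent {D D' : LinkDiagram} (h : Separable D) (hD : Equivalent D D') :
    Separable D' := by
  obtain ⟨f, hf, hg⟩ := h
  obtain ⟨e, he⟩ := hD
  refine ⟨e _ f, fun q => ?_, fun g => ?_⟩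
  · rw [Coloring.isConst_apply_iff e he]
    exact hf q
  · obtain ⟨c, h₁, h₂⟩ := hg ((e _).symm g)
    exact ⟨e _ c, by rw [← he, h₁], by rw [← he, h₂, Equiv.apply_symm_apply]⟩

theorem Coloring.exists_mem {D : LinkDiagram} (hD : D.word ≠ []) (c : Coloring D Q) :
    ∃ l ∈ c.1, ∃ x, x ∈ l := by
  obtain ⟨_ | ⟨s, w⟩, closed⟩ := D
  · exact absurd rfl hD
  · obtain ⟨_, b, L, rfl, hs, -⟩ := c
    obtain ⟨h₁, h₂⟩ := hs.length
    refine ⟨b, List.mem_cons_self, List.exists_mem_of_length_pos ?_⟩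
    rw [h₂]
    rcases s with ⟨_ | _ | _, i⟩ <;> simp [Piece.ins, Piece.outs] at h₁ ⊢

theorem exists_isConst (D : LinkDiagram) (q : Q) : ∃ c : Coloring D Q, c.IsConst q := by
  obtain ⟨L, hL, hc⟩ := exists_isColored_const q D.closed
  exact ⟨⟨L, hL⟩, hc⟩

/-- The first mark is `true` on one part and `false` on the other. No crossing involves both parts,
so each part lifts by `Marked.isHom_mk`. -/
theorem separable_stack {D₁ D₂ : LinkDiagram} (h₁ : D₁.word ≠ []) (h₂ : D₂.word ≠ []) :
    Separable (D₁.stack D₂) := by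
  obtain ⟨c₁, hc₁⟩ := exists_isConst D₁ true
  obtain ⟨c₂, hc₂⟩ := exists_isConst D₂ false
  refine ⟨⟨c₁.1 ++ c₂.1, c₁.2.append c₂.2⟩, fun q hq => ?_, fun g => ?_⟩
  · obtain ⟨l₁, hl₁, x₁, hx₁⟩ := c₁.exists_mem h₁
    obtain ⟨l₂, hl₂, x₂, hx₂⟩ := c₂.exists_mem h₂
    have e₁ := hq l₁ (List.mem_append_left _ hl₁) x₁ hx₁
    have e₂ := hq l₂ (List.mem_append_right _ hl₂) x₂ hx₂
    rw [hc₁ l₁ hl₁ x₁ hx₁] at e₁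
    rw [hc₂ l₂ hl₂ x₂ hx₂] at e₂
    exact absurd (e₁.trans e₂.symm) (by simp)
  · obtain ⟨L, hL⟩ := g
    obtain ⟨G₁, G₂, a, rfl, hG₁, hG₂⟩ := isColored_append.1 hL
    obtain rfl : a = [] := List.length_eq_zero_iff.1 (hG₁.isTangle.unique D₁.closed)
    have k₁ := congrArg Subtype.val (Coloring.eq_of_isConst
      (Coloring.isConst_map (⟨G₁, hG₁⟩ : Coloring D₁ Bool) true) hc₁)
    have k₂ := congrArg Subtype.val (Coloring.eq_of_isConst
      (Coloring.isConst_map (⟨G₂, hG₂⟩ : Coloring D₂ Bool) false) hc₂)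
    simp only [Coloring.map] at k₁ k₂
    have hc := (hG₁.map (Marked.isHom_mk true)).append (hG₂.map (Marked.isHom_mk false))
    refine ⟨⟨_, hc⟩, Subtype.ext ?_, Subtype.ext ?_⟩
    · simp only [Coloring.map, List.map_append, List.map_map, ← k₁, ← k₂]
      congr 1 <;> refine List.map_congr_left fun l _ => ?_ <;>
        simp only [Function.comp, List.map_map] <;> rfl
    · simp only [Coloring.map, List.map_append, List.map_map]
      congr 1 <;> refine (List.map_congr_left fun l _ => ?_).trans (List.map_id _) <;>
        simp [Function.comp_def]

theorem separable_of_isSplit {D : LinkDiagram} (h : D.link.IsSplit) : Separable D := by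
  obtain ⟨D₁, D₂, h₁, h₂, h⟩ := h
  exact (separable_stack h₁ h₂).of_equivalent (equivalent_of_link_eq h)

/-! ## Colorings of pretzel diagrams -/

/-- The list with each entry repeated. -/
def dup {α : Type} : List α → List α
  | [] => []
  | x :: l => x :: x :: dup l

theorem dup_append {α : Type} (l l' : List α) : dup (l ++ l') = dup l ++ dup l' := by
  induction l with
  | nil => rfl
  | cons x l ih => simp [dup, ih]

theorem length_dup {α : Type} (l : List α) : (dup l).length = 2 * l.length := by
  induction l with
  | nil => rfl
  | cons x l ih => simp only [dup, List.length_cons, ih]; omega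

theorem dup_injective {α : Type} : Function.Injective (dup : List α → List α) := by
  intro l l' h
  induction l generalizing l' with
  | nil => cases l' <;> simp_all [dup]
  | cons x l ih =>
    cases l' with
    | nil => simp [dup] at h
    | cons y l' =>
      simp only [dup, List.cons.injEq] at h
      rw [h.1, ih h.2.2]

theorem mem_dup {α : Type} {l : List α} {x : α} : x ∈ dup l ↔ x ∈ l := by
  induction l with
  | nil => rfl
  | cons y l ih => simp [dup, ih]

theorem map_dup {α β : Type} (φ : α → β) (l : List α) : (dup l).map φ = dup (l.map φ) := by
  induction l with
  | nil => rfl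
  | cons y l ih => simp [dup, ih]

/-- There is a coloring of `w`, with `a` at the bottom and `b` at the top, whose levels above the
slices only use colors in `S`. -/
def Reach (S : Set Q) (w : List Slice) (a b : List Q) : Prop :=
  ∃ L, IsColored w a L b ∧ ∀ l ∈ L, ∀ x ∈ l, x ∈ S

theorem Reach.append {S : Set Q} {u v : List Slice} {a b c : List Q} (h : Reach S u a b)
    (h' : Reach S v b c) : Reach S (u ++ v) a c := by
  obtain ⟨L, hL, hS⟩ := h
  obtain ⟨L', hL', hS'⟩ := h'
  refine ⟨_, hL.append hL', fun l hl => ?_⟩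
  rcases List.mem_append.1 hl with hl | hl
  exacts [hS l hl, hS' l hl]

theorem Reach.nil (S : Set Q) (a : List Q) : Reach S [] a a := ⟨[], ⟨rfl, rfl⟩, by simp⟩

theorem Reach.cons {S : Set Q} {s : Slice} {w : List Slice} {a b c : List Q}
    (hs : Step s.piece s.pos a b) (hb : ∀ x ∈ b, x ∈ S) (h : Reach S w b c) :
    Reach S (s :: w) a c := by
  obtain ⟨L, hL, hS⟩ := h
  refine ⟨_, ⟨_, _, rfl, hs, hL⟩, ?_⟩
  simp only [List.mem_cons, forall_eq_or_imp]
  exact ⟨hb, hS⟩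

theorem Reach.addStrand {S : Set Q} {w : List Slice} {a b : List Q} {x : Q} (h : Reach S w a b)
    (hx : x ∈ S) : Reach S (addStrand w) (x :: a) (x :: b) := by
  obtain ⟨L, hL, hS⟩ := h
  refine ⟨_, isColored_addStrand.2 ⟨_, _, rfl, rfl, hL⟩, ?_⟩
  simp only [List.mem_map, forall_exists_index, and_imp, forall_apply_eq_imp_iff₂, List.mem_cons,
    forall_eq_or_imp]
  exact fun l hl => ⟨hx, hS l hl⟩

/-- Every minimum is inserted at position 1, so the pair created first ends up rightmost; hence the
induction from the end of the list. -/
theorem reach_cups {S : Set Q} (l : List Q) {q : Q} {a : List Q}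
    (h : ∀ x ∈ q :: (dup l ++ a), x ∈ S) :
    Reach S (List.replicate l.length ⟨.cup, 1⟩) (q :: a) (q :: (dup l ++ a)) := by
  induction l using List.reverseRecOn generalizing a with
  | nil => exact Reach.nil S _
  | append_singleton l x ih =>
    have e : dup (l ++ [x]) ++ a = dup l ++ x :: x :: a := by simp [dup_append, dup]
    rw [e] at h ⊢
    rw [List.length_append, List.length_singleton, List.replicate_succ]
    exact Reach.cons (step_succ_cons.2 ⟨_, rfl, x, rfl⟩)
      (fun y hy => h y (by simp at hy ⊢; tauto)) (ih h)

theorem reach_caps {S : Set Q} (l : List Q) {q : Q} {a : List Q}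
    (h : ∀ x ∈ q :: (dup l ++ a), x ∈ S) :
    Reach S (List.replicate l.length ⟨.cap, 1⟩) (q :: (dup l ++ a)) (q :: a) := by
  induction l with
  | nil => exact Reach.nil S _
  | cons x l ih =>
    rw [List.length_cons, List.replicate_succ]
    have h' : ∀ y ∈ q :: (dup l ++ a), y ∈ S := fun y hy => h y (by simp [dup] at hy ⊢; tauto)
    exact Reach.cons (step_succ_cons.2 ⟨_, rfl, x, rfl⟩) h' (ih h')

theorem IsColored.exists_of_cups {k : ℕ} {q : Q} {a b : List Q} {L : List (List Q)}
    (h : IsColored (List.replicate k ⟨.cup, 1⟩) (q :: a) L b) :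
    ∃ l, l.length = k ∧ b = q :: (dup l ++ a) := by
  induction k generalizing a L with
  | zero => exact ⟨[], rfl, h.2.symm⟩
  | succ k ih =>
    obtain ⟨c, L, rfl, hs, h⟩ := h
    obtain ⟨_, rfl, x, rfl⟩ := step_succ_cons.1 hs
    obtain ⟨l, rfl, rfl⟩ := ih h
    exact ⟨l ++ [x], by simp, by simp [dup_append, dup]⟩

theorem IsColored.exists_of_caps {k : ℕ} {q : Q} {a b : List Q} {L : List (List Q)}
    (h : IsColored (List.replicate k ⟨.cap, 1⟩) b L (q :: a)) :
    ∃ l, l.length = k ∧ b = q :: (dup l ++ a) := by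
  induction k generalizing b L with
  | zero => exact ⟨[], rfl, h.2⟩
  | succ k ih =>
    obtain ⟨c, L, rfl, hs, h⟩ := h
    obtain ⟨l, rfl, rfl⟩ := ih h
    obtain ⟨x, b, _, rfl, e, y, rfl⟩ := hs
    obtain ⟨rfl, rfl⟩ := List.cons.inj e
    exact ⟨y :: l, rfl, rfl⟩

/-- The slices below the columns of a pretzel diagram with `k + 1` columns. -/
def cups (k : ℕ) : List Slice := ⟨.cup, 0⟩ :: List.replicate k ⟨.cup, 1⟩

/-- The slices above the columns of a pretzel diagram with `k + 1` columns. -/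
def caps (k : ℕ) : List Slice := List.replicate k ⟨.cap, 1⟩ ++ [⟨.cap, 0⟩]

theorem pretzelDiagram_word (p : List ℤ) : (pretzelDiagram p).word =
    cups (p.length - 1) ++ twistColumns 0 p ++ caps (p.length - 1) := rfl

theorem isColored_last {w : List Slice} {a b : List Q} {L : List (List Q)}
    (h : IsColored w a L b) : (a :: L).getD w.length [] = b := by
  induction w generalizing a L with
  | nil => obtain ⟨rfl, rfl⟩ := h; rfl
  | cons s w ih =>
    obtain ⟨c, L, rfl, -, h⟩ := h
    simpa using ih h

theorem IsColored.getD_cups {k : ℕ} {a : List Q} {L : List (List Q)}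
    (h : IsColored (cups k) [] L a) (L' : List (List Q)) : (L ++ L').getD k [] = a := by
  have e := h.length_levels
  rw [← isColored_last h]
  simp only [cups, List.length_cons, List.length_replicate] at e ⊢
  simp only [List.getD_eq_getElem?_getD, List.getElem?_cons_succ]
  rw [List.getElem?_append_left (by omega)]

/-- The colors on the level below the columns. -/
def Coloring.bottom {p : List ℤ} (c : Coloring (pretzelDiagram p) Q) : List Q :=
  c.1.getD (p.length - 1) []

theorem Coloring.bottom_map {p : List ℤ} (c : Coloring (pretzelDiagram p) Q) (φ : Q → R)
    (hφ : IsHom φ) : (c.map φ hφ).bottom = c.bottom.map φ := by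
  simp only [bottom, map, List.getD_eq_getElem?_getD, List.getElem?_map]
  cases c.1[p.length - 1]? <;> rfl

theorem Coloring.exists_eq_append {p : List ℤ} (c : Coloring (pretzelDiagram p) Q) :
    ∃ L₁ L₂ L₃ b, c.1 = L₁ ++ (L₂ ++ L₃) ∧ IsColored (cups (p.length - 1)) [] L₁ c.bottom ∧
      IsColored (twistColumns 0 p) c.bottom L₂ b ∧ IsColored (caps (p.length - 1)) b L₃ [] := by
  obtain ⟨L, h⟩ := c
  have h' := h
  rw [pretzelDiagram_word, List.append_assoc] at h'
  obtain ⟨L₁, L', a, rfl, h₁, h'⟩ := isColored_append.1 h'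
  obtain ⟨L₂, L₃, b, rfl, h₂, h₃⟩ := isColored_append.1 h'
  simp only [bottom, h₁.getD_cups]
  exact ⟨L₁, L₂, L₃, b, rfl, h₁, h₂, h₃⟩

theorem twistColumns_succ (p : List ℤ) (i : ℕ) :
    twistColumns (i + 1) p = addStrand (twistColumns i p) := by
  induction p generalizing i with
  | nil => rfl
  | cons a p ih => simp [twistColumns, addStrand, ih]

theorem twistColumns_ne_cup (p : List ℤ) (i : ℕ) : ∀ s ∈ twistColumns i p, s.piece ≠ .cup := by
  induction p generalizing i with
  | nil => simp [twistColumns]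
  | cons a p ih =>
    intro s hs
    rcases List.mem_append.1 hs with hs | hs
    · simp [List.eq_of_mem_replicate hs]
    · exact ih _ s hs

/-- There are no minima above this level and only minima below it, so its colors propagate uniquely
in both directions. -/
theorem Coloring.ext_bottom {p : List ℤ} {c c' : Coloring (pretzelDiagram p) Q}
    (h : c.bottom = c'.bottom) : c = c' := by
  obtain ⟨L₁, L₂, L₃, b, e, h₁, h₂, h₃⟩ := c.exists_eq_append
  obtain ⟨L₁', L₂', L₃', b', e', h₁', h₂', h₃'⟩ := c'.exists_eq_append
  rw [← h] at h₁' h₂'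
  have hw : ∀ s ∈ twistColumns 0 p ++ caps (p.length - 1), s.piece ≠ .cup := by
    intro s hs
    simp only [caps, List.mem_append, List.mem_singleton] at hs
    rcases hs with hs | hs | rfl
    · exact twistColumns_ne_cup _ _ s hs
    · simp [List.eq_of_mem_replicate hs]
    · simp
  refine Subtype.ext ?_
  rw [e, e', ((h₂.append h₃).eq_of_forall_ne_cup hw (h₂'.append h₃')).1,
    (h₁.eq_of_forall_eq_cup ?_ h₁').1]
  simp [cups]

/-- The outermost minimum gives both ends the color `q`; each of the others colors two neighboring
ends of adjacent columns. -/
theorem Coloring.exists_bottom_eq {p : List ℤ} (c : Coloring (pretzelDiagram p) Q) :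
    ∃ q l, l.length = p.length - 1 ∧ c.bottom = q :: (dup l ++ [q]) := by
  obtain ⟨L₁, L₂, L₃, b, -, ⟨_, L₁, rfl, ⟨q, rfl⟩, h₁⟩, -, -⟩ := c.exists_eq_append
  obtain ⟨l, hl, h⟩ := h₁.exists_of_cups
  exact ⟨q, l, hl, h⟩

theorem Coloring.exists_isColored_twistColumns {p : List ℤ} (c : Coloring (pretzelDiagram p) Q) :
    ∃ L r m, IsColored (twistColumns 0 p) c.bottom L (r :: (dup m ++ [r])) := by
  obtain ⟨L₁, L₂, L₃, b, -, -, h₂, h₃⟩ := c.exists_eq_append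
  obtain ⟨L, L', a, rfl, h₄, h₅⟩ := isColored_append.1 h₃
  obtain ⟨-, q, rfl⟩ := isColored_singleton.1 h₅
  obtain ⟨m, -, rfl⟩ := h₄.exists_of_caps
  exact ⟨L₂, q, m, h₂⟩

theorem exists_coloring {S : Set Q} {p : List ℤ} (q r : Q) (l m : List Q)
    (hl : l.length = p.length - 1) (hm : m.length = p.length - 1)
    (hlS : ∀ x ∈ q :: l, x ∈ S) (hmS : ∀ x ∈ r :: m, x ∈ S)
    (h : Reach S (twistColumns 0 p) (q :: (dup l ++ [q])) (r :: (dup m ++ [r]))) :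
    ∃ c : Coloring (pretzelDiagram p) Q, c.bottom = q :: (dup l ++ [q]) ∧
      ∀ a ∈ c.1, ∀ x ∈ a, x ∈ S := by
  have hl' : ∀ x ∈ q :: (dup l ++ [q]), x ∈ S := fun x hx =>
    hlS x (by simp [mem_dup] at hx ⊢; tauto)
  have hm' : ∀ x ∈ r :: (dup m ++ [r]), x ∈ S := fun x hx =>
    hmS x (by simp [mem_dup] at hx ⊢; tauto)
  have h₁ : Reach S (cups (p.length - 1)) [] (q :: (dup l ++ [q])) :=
    Reach.cons ⟨q, rfl⟩ (fun x hx => hl' x (by simp at hx ⊢; tauto)) (hl ▸ reach_cups l hl')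
  have h₂ : Reach S (caps (p.length - 1)) (r :: (dup m ++ [r])) [] :=
    Reach.append (hm ▸ reach_caps m hm')
      (Reach.cons ⟨r, rfl⟩ (by simp) (Reach.nil S _))
  obtain ⟨L₁, h₁, hS₁⟩ := h₁
  obtain ⟨L₂, h₂, hS₂⟩ := h.append h₂
  have hc : IsColored (pretzelDiagram p).word [] (L₁ ++ L₂) [] := by
    rw [pretzelDiagram_word, List.append_assoc]
    exact h₁.append h₂
  refine ⟨⟨_, hc⟩, h₁.getD_cups L₂, fun a ha => ?_⟩
  rcases List.mem_append.1 ha with ha | ha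
  exacts [hS₁ a ha, hS₂ a ha]

theorem twistColumns_cons (a : ℤ) (p : List ℤ) :
    twistColumns 0 (a :: p) = List.replicate a.natAbs ⟨.cross (decide (0 < a)), 0⟩ ++
      addStrand (addStrand (twistColumns 0 p)) := by
  rw [← twistColumns_succ, ← twistColumns_succ]
  rfl

theorem reach_two {S : Set Q} {p : List ℤ} {x y : Q} {a b : List Q}
    (h : Reach S (twistColumns 0 p) a b) (ha : ∀ z ∈ a, z ∈ S) (hx : x ∈ S) (h₁ : y ◁ x ∈ S)
    (h₂ : x ◁ (y ◁ x) ∈ S) :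
    Reach S (twistColumns 0 (2 :: p)) (x :: y :: a) ((x ◁ (y ◁ x)) :: (y ◁ x) :: b) := by
  rw [twistColumns_cons]
  exact Reach.append (Reach.cons (step_cross_true_zero.2 rfl)
    (by simpa [*] using ha)
    (Reach.cons (step_cross_true_zero.2 rfl) (by simpa [*] using ha) (Reach.nil S _)))
    ((h.addStrand h₁).addStrand h₂)

theorem reach_neg_two {S : Set Q} {p : List ℤ} {x y : Q} {a b : List Q}
    (h : Reach S (twistColumns 0 p) a b) (ha : ∀ z ∈ a, z ∈ S) (hy : y ∈ S) (h₁ : x ◁ y ∈ S)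
    (h₂ : y ◁ (x ◁ y) ∈ S) :
    Reach S (twistColumns 0 (-2 :: p)) (x :: y :: a) ((x ◁ y) :: (y ◁ (x ◁ y)) :: b) := by
  rw [twistColumns_cons]
  exact Reach.append (Reach.cons (step_cross_false_zero.2 rfl)
    (by simpa [*] using ha)
    (Reach.cons (step_cross_false_zero.2 rfl) (by simpa [*] using ha) (Reach.nil S _)))
    ((h.addStrand h₂).addStrand h₁)

theorem IsColored.exists_of_two {p : List ℤ} {x y : Q} {a b : List Q} {L : List (List Q)}
    (h : IsColored (twistColumns 0 (2 :: p)) (x :: y :: a) L b) :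
    ∃ L' b', IsColored (twistColumns 0 p) a L' b' ∧ b = (x ◁ (y ◁ x)) :: (y ◁ x) :: b' := by
  rw [twistColumns_cons] at h
  obtain ⟨L₁, L₂, c, rfl, h₁, h₂⟩ := isColored_append.1 h
  obtain ⟨d, -, hd, hd'⟩ := isColored_pair.1 h₁
  obtain rfl := step_cross_true_zero.1 hd
  obtain rfl := step_cross_true_zero.1 hd'
  obtain ⟨L₃, b, -, rfl, h₃⟩ := isColored_addStrand.1 h₂
  obtain ⟨L₄, b, -, rfl, h₄⟩ := isColored_addStrand.1 h₃
  exact ⟨L₄, b, h₄, rfl⟩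

theorem IsColored.exists_of_neg_two {p : List ℤ} {x y : Q} {a b : List Q} {L : List (List Q)}
    (h : IsColored (twistColumns 0 (-2 :: p)) (x :: y :: a) L b) :
    ∃ L' b', IsColored (twistColumns 0 p) a L' b' ∧ b = (x ◁ y) :: (y ◁ (x ◁ y)) :: b' := by
  rw [twistColumns_cons] at h
  obtain ⟨L₁, L₂, c, rfl, h₁, h₂⟩ := isColored_append.1 h
  obtain ⟨d, -, hd, hd'⟩ := isColored_pair.1 h₁
  obtain rfl := step_cross_false_zero.1 hd
  obtain rfl := step_cross_false_zero.1 hd'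
  obtain ⟨L₃, b, -, rfl, h₃⟩ := isColored_addStrand.1 h₂
  obtain ⟨L₄, b, -, rfl, h₄⟩ := isColored_addStrand.1 h₃
  exact ⟨L₄, b, h₄, rfl⟩

theorem alternatingTwos_succ (n : ℕ) :
    alternatingTwos (n + 1) = 2 :: -2 :: alternatingTwos n := rfl

theorem length_alternatingTwos (n : ℕ) : (alternatingTwos n).length = 2 * n := by
  induction n with
  | zero => rfl
  | succ n ih => simp only [alternatingTwos_succ, List.length_cons, ih]; omega

theorem mem_alternatingTwos {n : ℕ} {a : ℤ} (h : a ∈ alternatingTwos n) : a = 2 ∨ a = -2 := by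
  simp only [alternatingTwos, List.mem_flatten, List.mem_replicate] at h
  obtain ⟨l, ⟨-, rfl⟩, h⟩ := h
  simpa using h

/-! ### Colorings by two colors that do not interact -/

/-- Two crossings return each strand to its place, and the trivial operation leaves its color
unchanged. -/
theorem reach_bool (p : List ℤ) (hp : ∀ a ∈ p, a = 2 ∨ a = -2) (a : List Bool)
    (ha : 2 * p.length ≤ a.length) : Reach Set.univ (twistColumns 0 p) a a := by
  induction p generalizing a with
  | nil => exact Reach.nil _ _
  | cons b p ih =>
    obtain ⟨x, a, rfl, h'⟩ := exists_cons_of_lt (k := 2 * p.length + 1) (a := a)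
      (by simp only [List.length_cons] at ha; omega)
    obtain ⟨y, a, rfl, h''⟩ := exists_cons_of_lt h'
    have := ih (fun c hc => hp c (by simp [hc])) a h''
    rcases hp b (by simp) with rfl | rfl
    · exact reach_two this (by simp) trivial trivial trivial
    · exact reach_neg_two this (by simp) trivial trivial trivial

theorem exists_bool_coloring (n : ℕ) (q : Bool) (l : List Bool) (hl : l.length = 2 * n - 1) :
    ∃ c : Coloring (pretzelDiagram (alternatingTwos n)) Bool, c.bottom = q :: (dup l ++ [q]) := by
  have e := length_alternatingTwos n
  obtain ⟨c, hc, -⟩ := exists_coloring (S := Set.univ) (p := alternatingTwos n) q q l l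
    (by rw [e, hl]) (by rw [e, hl]) (by simp) (by simp)
    (reach_bool _ (fun _ => mem_alternatingTwos) _ (by simp [length_dup]; omega))
  exact ⟨c, hc⟩

/-- The `2n` lower arcs lie on different components and can be colored independently. -/
theorem card_bool_coloring (n : ℕ) :
    Nat.card (Coloring (pretzelDiagram (alternatingTwos n)) Bool) = 2 * 2 ^ (2 * n - 1) := by
  have h (v : Bool × List.Vector Bool (2 * n - 1)) := exists_bool_coloring n v.1 v.2.1 v.2.2
  choose F hF using h
  have hb : Function.Bijective F := by
    constructor
    · intro v v' hv
      have := hF v'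
      rw [← hv, hF v] at this
      simp only [List.cons.injEq] at this
      exact Prod.ext this.1 (Subtype.ext (dup_injective (by simpa [this.1] using this.2)))
    · intro c
      obtain ⟨q, l, hl, hc⟩ := c.exists_bottom_eq
      rw [length_alternatingTwos] at hl
      exact ⟨(q, ⟨l, hl⟩), Coloring.ext_bottom (by rw [hF, hc])⟩
  rw [← Nat.card_congr (Equiv.ofBijective F hb), Nat.card_prod, Nat.card_eq_fintype_card,
    Nat.card_eq_fintype_card, card_vector, Fintype.card_bool]

theorem injOn_alternatingPretzel : Set.InjOn alternatingPretzel {n : ℕ | 2 ≤ n} := by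
  intro n hn n' hn' h
  obtain ⟨e, -⟩ := equivalent_of_link_eq h
  have := Nat.card_congr (e Bool)
  rw [card_bool_coloring, card_bool_coloring] at this
  have := Nat.pow_right_injective le_rfl (Nat.eq_of_mul_eq_mul_left two_pos this)
  simp only [Set.mem_ofPred_eq] at hn hn'
  omega

/-! ### Colorings by four integers -/

/-- Column `2` takes `(0, 1)` to `(-2, -1)` and column `-2` takes `(1, 0)` to `(-1, -2)`, with `-1`
as the only intermediate color. Neighboring columns match at both ends. -/
theorem reach_int (n : ℕ) : Reach ({0, 1, -1, -2} : Set ℤ) (twistColumns 0 (alternatingTwos n))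
    (List.replicate n [0, 1, 1, 0]).flatten (List.replicate n [-2, -1, -1, -2]).flatten := by
  induction n with
  | zero => exact Reach.nil _ _
  | succ n ih =>
    have hS : ∀ z ∈ (List.replicate n [(0 : ℤ), 1, 1, 0]).flatten, z ∈ ({0, 1, -1, -2} : Set ℤ) := by
      intro z hz
      simp only [List.mem_flatten, List.mem_replicate] at hz
      obtain ⟨l, ⟨-, rfl⟩, hz⟩ := hz
      simp at hz ⊢
      tauto
    have h₁ := reach_neg_two (x := (1 : ℤ)) (y := 0) ih hS (by simp) (by simp [op]) (by simp [op])
    have h₂ := reach_two (x := (0 : ℤ)) (y := 1) h₁ (by simpa using hS) (by simp) (by simp [op])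
      (by simp [op])
    exact h₂

theorem flatten_replicate_eq {α : Type} (x y : α) (n : ℕ) :
    (List.replicate (n + 1) [x, y, y, x]).flatten =
      x :: (dup (y :: (List.replicate n [x, y]).flatten) ++ [x]) := by
  induction n with
  | zero => rfl
  | succ n ih =>
    rw [List.replicate_succ, List.flatten_cons, ih]
    simp [List.replicate_succ, dup]

theorem exists_int_coloring {n : ℕ} (hn : n ≠ 0) :
    ∃ c : Coloring (pretzelDiagram (alternatingTwos n)) ℤ,
      (∀ l ∈ c.1, ∀ x ∈ l, x ∈ ({0, 1, -1, -2} : Set ℤ)) ∧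
      ∃ l ∈ c.1, 0 ∈ l ∧ 1 ∈ l := by
  obtain ⟨n, rfl⟩ := Nat.exists_eq_succ_of_ne_zero hn
  have h := reach_int (n + 1)
  rw [flatten_replicate_eq, flatten_replicate_eq] at h
  have mem {x y z : ℤ} (hz : z ∈ x :: y :: (List.replicate n [x, y]).flatten) : z = x ∨ z = y := by
    simp only [List.mem_cons, List.mem_flatten, List.mem_replicate] at hz
    rcases hz with hz | hz | ⟨l, ⟨-, rfl⟩, hz⟩
    · exact .inl hz
    · exact .inr hz
    · simpa using hz
  obtain ⟨c, hc, hS⟩ := exists_coloring 0 (-2) _ _ (by simp [length_alternatingTwos]; omega)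
    (by simp [length_alternatingTwos]; omega)
    (fun z hz => by rcases mem hz with rfl | rfl <;> simp)
    (fun z hz => by rcases mem hz with rfl | rfl <;> simp) h
  refine ⟨c, hS, c.bottom, ?_, by simp [hc], by simp [hc, dup]⟩
  have hlen : (alternatingTwos (n + 1)).length - 1 < c.1.length := by
    rw [c.2.length_levels, pretzelDiagram_word]
    simp [cups]
  rw [Coloring.bottom, List.getD_eq_getElem _ _ hlen]
  exact List.getElem_mem _

/-! ### Pretzel links are not split -/

/-- In a clasp each component passes once under the other. The upper arc of `b` therefore gets the
color `b ◁ a` from the column on its left and `b ◁ c` from the one on its right. -/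
theorem Marked.op_eq_op_of_isColored {p : List ℤ} (hp : ∀ a ∈ p, a = 2 ∨ a = -2)
    {l m : List Marked} (hl : p.length = l.length + 1) {x z r s : Marked}
    {L : List (List Marked)}
    (h : IsColored (twistColumns 0 p) (x :: (dup l ++ [z])) L (r :: (dup m ++ [s]))) :
    (∀ y t, l ++ [z] = y :: t → r = x ◁ y) ∧
    ∀ u a b c v, x :: (l ++ [z]) = u ++ a :: b :: c :: v → b ◁ a = b ◁ c := by
  induction p generalizing l m x r L with
  | nil => simp at hl
  | cons e p ih =>
    -- Acting by an element uses only its marks, which `◁` preserves; so both signs of a column have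
    -- the same effect.
    have key {y : Marked} {a d : List Marked} (h : IsColored (twistColumns 0 (e :: p))
        (x :: y :: a) L d) :
        ∃ L' d', IsColored (twistColumns 0 p) a L' d' ∧ d = (x ◁ y) :: (y ◁ x) :: d' := by
      rcases hp e (by simp) with rfl | rfl
      · exact IsColored.exists_of_two h
      · exact IsColored.exists_of_neg_two h
    cases l with
    | nil =>
      obtain ⟨L', d, -, e⟩ := key h
      simp only [List.cons.injEq] at e
      refine ⟨fun y t ht => ?_, fun u a b c v hu => ?_⟩
      · simp only [List.nil_append, List.cons.injEq] at ht
        rw [e.1, ht.1]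
      · have := congrArg List.length hu
        simp at this
        omega
    | cons y l =>
      obtain ⟨L', d, h', e⟩ := key (a := y :: (dup l ++ [z])) h
      have hlen := h'.isTangle.unique (isTangle_twistColumns p 0 _ (by
        simp only [List.length_cons, List.length_append, length_dup] at hl ⊢; omega))
      rcases m with _ | ⟨m₁, m⟩
      · simp only [dup, List.nil_append, List.cons.injEq] at e
        rw [← e.2.2] at hlen
        simp at hlen
      · simp only [dup, List.cons_append, List.cons.injEq] at e
        obtain ⟨rfl, rfl, rfl⟩ := e
        obtain ⟨ih₁, ih₂⟩ := ih (fun a ha => hp a (by simp [ha])) (by simpa using hl) h'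
        refine ⟨fun y' t ht => ?_, fun u a b c v hu => ?_⟩
        · simp only [List.cons_append, List.cons.injEq] at ht
          rw [ht.1]
        · rcases u with _ | ⟨u₁, u⟩
          · simp only [List.nil_append, List.cons_append, List.cons.injEq] at hu
            obtain ⟨rfl, rfl, hu⟩ := hu
            exact ih₁ _ _ hu
          · simp only [List.cons_append, List.cons.injEq] at hu
            exact ih₂ u a b c v hu.2

theorem exists_adjacent_ne {α : Type} {q : α} {l : List α} (h : ∃ x ∈ l, x ≠ q) :
    ∃ u a b v, q :: l = u ++ a :: b :: v ∧ a ≠ b := by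
  induction l generalizing q with
  | nil => simp at h
  | cons y l ih =>
    by_cases hy : q = y
    · subst hy
      obtain ⟨x, hx, hne⟩ := h
      obtain ⟨u, a, b, v, e, hab⟩ := ih ⟨x, by simpa [hne] using hx, hne⟩
      exact ⟨q :: u, a, b, v, by rw [e]; rfl, hab⟩
    · exact ⟨[], q, y, l, rfl, hy⟩

theorem Coloring.exists_ne_of_bottom {p : List ℤ} (c : Coloring (pretzelDiagram p) Q)
    (hc : ∀ q, ¬ c.IsConst q) {q : Q} {l : List Q} (h : c.bottom = q :: (dup l ++ [q])) :
    ∃ x ∈ l, x ≠ q := by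
  by_contra! hl
  refine hc q ?_
  have : c = c.map (fun _ => q) (isHom_const q) := by
    refine ext_bottom ?_
    rw [bottom_map]
    refine (List.map_id _).symm.trans (List.map_congr_left fun x hx => ?_)
    simp only [h, List.mem_cons, List.mem_append, mem_dup, List.not_mem_nil, or_false] at hx
    rcases hx with rfl | hx | rfl
    exacts [rfl, hl x hx, rfl]
  rw [this]
  exact isConst_map c q

theorem cons_inj_of_dup {α : Type} {q q' : α} {l l' : List α}
    (h : q :: (dup l ++ [q]) = q' :: (dup l' ++ [q'])) : q :: l = q' :: l' := by
  simp only [List.cons.injEq] at h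
  obtain ⟨rfl, h⟩ := h
  rw [dup_injective (List.append_cancel_right h)]

/-- Going once around the second of two marked neighbors with different `f`, the last entry changes
exactly once, namely under the first. -/
theorem not_separable {n : ℕ} (hn : 2 ≤ n) :
    ¬ Separable (pretzelDiagram (alternatingTwos n)) := by
  rintro ⟨f, hf, hg⟩
  obtain ⟨q, l, hl, hfl⟩ := f.exists_bottom_eq
  rw [length_alternatingTwos] at hl
  obtain ⟨u, a, b, v, e, hab⟩ := exists_adjacent_ne (f.exists_ne_of_bottom hf hfl)
  -- The second marking `g` is `true` exactly on the two neighbors where `f` changes.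
  obtain ⟨q', l', e'⟩ : ∃ q' l',
      u.map (fun _ => false) ++ true :: true :: v.map (fun _ => false) = q' :: l' :=
    List.exists_cons_of_ne_nil (by simp)
  have len := congrArg List.length e
  have len' := congrArg List.length e'
  simp only [List.length_cons, List.length_append, List.length_map] at len len'
  obtain ⟨g, hgl⟩ := exists_bool_coloring n q' l' (by omega)
  obtain ⟨c, hcf, hcg⟩ := hg g
  obtain ⟨y, m, hm, hcm⟩ := c.exists_bottom_eq
  rw [← hcf, Coloring.bottom_map, hcm] at hfl
  rw [← hcg, Coloring.bottom_map, hcm] at hgl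
  simp only [List.map_cons, List.map_append, List.map_nil, map_dup] at hfl hgl
  have h₁ := (cons_inj_of_dup hfl).trans e
  have h₂ := (cons_inj_of_dup hgl).trans e'.symm
  rw [← List.map_cons] at h₁ h₂
  obtain ⟨u', w, e₁, hu', hw⟩ := List.map_eq_append_iff.1 h₁
  obtain ⟨A, w, rfl, rfl, hw'⟩ := List.map_eq_cons_iff.1 hw
  obtain ⟨B, v', rfl, rfl, -⟩ := List.map_eq_cons_iff.1 hw'
  rw [e₁, List.map_append] at h₂
  obtain ⟨h₃, h₄⟩ := List.append_inj h₂ (by rw [← hu']; simp)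
  simp only [List.map_cons, List.cons.injEq] at h₄
  obtain ⟨hA, hB, h₄⟩ := h₄
  have false_of_mem {s : List Bool} {t : List Marked}
      (h : t.map Marked.g = s.map fun _ => false) {x : Marked} (hx : x ∈ t) : x.g = false := by
    have := List.mem_map_of_mem (f := Marked.g) hx
    rw [h] at this
    obtain ⟨-, -, h⟩ := List.mem_map.1 this
    exact h.symm
  -- `E` is the cyclic successor of `B`. It is unmarked because there are at least four components,
  -- so it is not `A` again.
  obtain ⟨E, t, hE, ht⟩ : ∃ E t, v' ++ [y] = E :: t ∧ E.g = false := by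
    rcases v' with _ | ⟨E, t⟩
    · refine ⟨y, [], rfl, false_of_mem h₃ ?_⟩
      rcases u' with _ | ⟨z, u'⟩
      · have := congrArg List.length e₁
        rw [length_alternatingTwos] at hm
        simp at this
        omega
      · rw [(List.cons.inj e₁).1]
        simp
    · exact ⟨E, t ++ [y], rfl, false_of_mem h₄ (by simp)⟩
  obtain ⟨L, r, k, hk⟩ := c.exists_isColored_twistColumns
  rw [hcm] at hk
  have := (Marked.op_eq_op_of_isColored (fun _ => mem_alternatingTwos)
    (by rw [length_alternatingTwos] at hm ⊢; omega) hk).2 u' A B E t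
    (by rw [← List.cons_append, e₁, ← hE]; simp)
  have := congrArg Marked.a this
  simp only [op, hA, hB, ht] at this
  -- `B ◁ A` flips the last entry of `B`, since `A` and `B` differ in `f` and are both marked; `B ◁
  -- E` does not.
  cases hA' : A.f <;> cases hB' : B.f <;> simp_all

theorem not_isSplit_alternatingPretzel {n : ℕ} (hn : 2 ≤ n) :
    ¬ (alternatingPretzel n).IsSplit := fun h => not_separable hn (separable_of_isSplit h)

theorem det_eq_zero_of_link_eq {n : ℕ} (hn : n ≠ 0) {D : LinkDiagram}
    (h : D.link = alternatingPretzel n) : D.det = 0 := by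
  obtain ⟨c, -, l, hl, h0, h1⟩ := exists_int_coloring hn
  obtain ⟨e, he⟩ := equivalent_of_link_eq h.symm
  refine (e ℤ c).det_eq_zero fun q => ?_
  rw [Coloring.isConst_apply_iff e he]
  exact fun hq => zero_ne_one ((hq l hl 0 h0).trans (hq l hl 1 h1).symm)

/-- The colors `0` and `1` of the integral coloring stay different modulo `m`. -/
theorem exists_isNontrivialColoring {n m : ℕ} (hn : n ≠ 0) (hm : 2 ≤ m) :
    ∃ f : (pretzelDiagram (alternatingTwos n)).Arc → ZMod m,
      (pretzelDiagram (alternatingTwos n)).IsNontrivialColoring m f ∧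
        (Set.range f).ncard ≤ 4 := by
  obtain ⟨c, hS, l, hl, h0, h1⟩ := exists_int_coloring hn
  have : Fact (1 < m) := ⟨hm⟩
  let c' : Coloring (pretzelDiagram (alternatingTwos n)) (ZMod m) := c.map _ (isHom_intCast m)
  have hl' : l.map Int.cast ∈ c'.1 := List.mem_map_of_mem hl
  refine ⟨c'.arcColor, c'.isNontrivialColoring fun q hq => ?_, ?_⟩
  · have e0 := hq _ hl' _ (List.mem_map_of_mem h0)
    have e1 := hq _ hl' _ (List.mem_map_of_mem h1)
    rw [← e1] at e0
    simp at e0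
  · have hsub : Set.range c'.arcColor ⊆
        ((({0, 1, -1, -2} : Finset ℤ).image Int.cast : Finset (ZMod m)) : Set (ZMod m)) := by
      rintro _ ⟨a, rfl⟩
      obtain ⟨k, hk, ha⟩ := c'.arcColor_mem a
      obtain ⟨k', hk', rfl⟩ := List.mem_map.1 hk
      obtain ⟨x, hx, hxa⟩ := List.mem_map.1 ha
      rw [← hxa, Finset.mem_coe]
      exact Finset.mem_image_of_mem _ (by simpa using hS k' hk' x hx)
    refine (Set.ncard_le_ncard hsub (Finset.finite_toSet _)).trans ?_
    rw [Set.ncard_coe_finset]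
    exact Finset.card_image_le

theorem isColorable_alternatingPretzel {n m : ℕ} (hn : n ≠ 0) (hm : 2 ≤ m) :
    (alternatingPretzel n).IsColorable m := by
  obtain ⟨f, hf, -⟩ := exists_isNontrivialColoring hn hm
  exact ⟨_, rfl, f, hf⟩

theorem mincol_alternatingPretzel_le {n m : ℕ} (hn : n ≠ 0) (hm : 2 ≤ m) :
    (alternatingPretzel n).mincol m ≤ 4 := by
  obtain ⟨f, hf, hcard⟩ := exists_isNontrivialColoring hn hm
  exact le_trans (Nat.sInf_le (⟨_, rfl, f, hf, rfl⟩ : _ ∈ {k : ℕ | ∃ D : LinkDiagram,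
    D.link = alternatingPretzel n ∧ ∃ f : D.Arc → ZMod m,
      D.IsNontrivialColoring m f ∧ (Set.range f).ncard = k})) hcard

end Kei

/-! ### The main theorem -/

theorem mainTheorem6 :
    -- the pretzel links are pairwise different links
    Set.InjOn alternatingPretzel {n : ℕ | 2 ≤ n} ∧
    -- they are non-split, have zero determinant and need at most four colors
    (∀ m : ℕ, 5 ≤ m → ∀ n : ℕ, 2 ≤ n →
      ¬ (alternatingPretzel n).IsSplit ∧
      (∀ D : LinkDiagram, D.link = alternatingPretzel n → D.det = 0) ∧
      (alternatingPretzel n).IsColorable m ∧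
      (alternatingPretzel n).mincol m ≤ 4) ∧
    -- so there are infinitely many such links for every modulus
    (∀ m : ℕ, 5 ≤ m →
      {L : Link | ¬ L.IsSplit ∧ (∀ D : LinkDiagram, D.link = L → D.det = 0) ∧
        L.IsColorable m ∧ L.mincol m ≤ 4}.Infinite) ∧
    -- and the lower bounds fail for non-split links
    (∀ p : ℕ, p.Prime → 11 ≤ p →
      ¬ ∀ L : Link, ¬ L.IsSplit → L.IsColorable p → 5 ≤ L.mincol p) ∧
    (∀ p : ℕ, p.Prime → 17 ≤ p →
      ¬ ∀ L : Link, ¬ L.IsSplit → L.IsColorable p → 6 ≤ L.mincol p) ∧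
    (∀ p : ℕ, p.Prime → 11 ≤ p →
      ¬ ∀ L : Link, ¬ L.IsSplit → L.IsColorable p → Nat.log 2 p + 2 ≤ L.mincol p) := by
  have key (m : ℕ) (hm : 5 ≤ m) (n : ℕ) (hn : 2 ≤ n) :
      ¬ (alternatingPretzel n).IsSplit ∧
      (∀ D : LinkDiagram, D.link = alternatingPretzel n → D.det = 0) ∧
      (alternatingPretzel n).IsColorable m ∧ (alternatingPretzel n).mincol m ≤ 4 :=
    ⟨Kei.not_isSplit_alternatingPretzel hn, fun _ h => Kei.det_eq_zero_of_link_eq (by omega) h,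
      Kei.isColorable_alternatingPretzel (by omega) (by omega),
      Kei.mincol_alternatingPretzel_le (by omega) (by omega)⟩
  -- The single link `P_2` refutes every lower bound that exceeds four.
  have bound (p k : ℕ) (hp : 5 ≤ p) (hk : 5 ≤ k) :
      ¬ ∀ L : Link, ¬ L.IsSplit → L.IsColorable p → k ≤ L.mincol p := by
    intro h
    obtain ⟨h₁, -, h₂, h₃⟩ := key p hp 2 le_rfl
    exact absurd (h _ h₁ h₂) (by omega)
  refine ⟨Kei.injOn_alternatingPretzel, key, fun m hm => ?_,
    fun p _ hp => bound p 5 (by omega) le_rfl,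
    fun p _ hp => bound p 6 (by omega) (by omega), fun p _ hp => bound p _ (by omega) ?_⟩
  · refine ((Set.Ici_infinite 2).image Kei.injOn_alternatingPretzel).mono ?_
    rintro _ ⟨n, hn, rfl⟩
    exact key m hm n hn
  -- Since `2 ^ 3 ≤ 11 ≤ p`, the logarithmic bound is at least five.
  · have : 3 ≤ Nat.log 2 p := Nat.le_log_of_pow_le (by omega) (by omega)
    omega
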